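/- A function $f:\{1,2,\dots\}\to\{1,2,\dots\}$ is \emph{slow} if $f(1)=1$, $f(2)=2$, $f(3)=3$ and $f(i)\le f(i+1)\le f(i)+1$ for all $i\ge 1$. Its \emph{cumulative function} is $F(k)=\sup\{i\ge 1 : f(i)\le k\}\in\{1,2,\dots\}\cup\{+\infty\}$ for $k\ge 1$. For a slow function $f$ and an integer $\ell\ge 4$, the \emph{$(f,\ell)$-layered wheel} $G$ is the underlying undirected graph of the following infinite oriented graph. Its vertex set is the disjoint union of layers $L_1,L_2,\dots$, each of which induces a directed cycle; every vertex $v\in L_i$ has a set $N^{\uparrow}(v)$ of neighbours in $L_1\cup\dots\cup L_{i-1}$, which contains at most one vertex of each layer and has at most $f(i)-1$ elements, and there are no edges between distinct layers other than those from $v$ to $N^\uparrow(v)$; write $N^{\uparrow}[v]=N^{\uparrow}(v)\cup\{v\}$. The layer $L_1$ is a directed cycle of length $\ell$, with all $N^\uparrow(v)$ empty. Given $L_1,\dots,L_i$, each $v\in L_i$ is assigned a directed path $L(v)=v_1\dots v_{n_v}$ of new vertices, and $L_{i+1}$ is the directed cycle obtained by concatenating the paths $L(v)$ in the cyclic order of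 the vertices $v$ of $L_i$. Put $m=f(i+1)-1$ (so that $|N^\uparrow(v)|\le m$). \begin{itemize} \item If $|N^{\uparrow}(v)|<m$, then $n_v=\ell-2$, $N^{\uparrow}(v_1)=N^{\uparrow}[v]$, and $N^{\uparrow}(v_j)=\emptyset$ for $2\le j\le \ell-2$. \item If $N^{\uparrow}(v)=\{w_1,\dots,w_m\}$, with the $w_j$ ordered by increasing layer, then $n_v=m(\ell-2)$, and for all $1\le j\le m$ we have $N^{\uparrow}(v_{(j-1)(\ell-2)+1})=N^{\uparrow}[v]\setminus\{w_j\}$ and $N^{\uparrow}(v_{(j-1)(\ell-2)+j'})=\emptyset$ for $2\le j'\le \ell-2$. \end{itemize} Write $\omega$ for the clique number and $\mathrm{tw}$ for the treewidth. \textbf{Lemma.} Let $\ell\ge 4$ be an integer, $f$ a slow function with cumulative function $F$, and $G$ the $(f,\ell)$-layered wheel. \begin{itemize} \item Every finite induced subgraph $H$ of $G$ with at least one vertex satisfies $$\mathrm{tw}(H)\le 15\bigl(F(\omega(H)+1)+(\ell+1)\,\omega(H)-2\bigr)$$ (where the right-hand side is $+\infty$ if $F(\omega(H)+1)=+\infty$).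 \item For every integer $k\ge 2$ such that $F(k-1)$ is finite and every integer $t\le F(k)$, there is a finite induced subgraph $H$ of $G$ with $\omega(H)=k$ and $\mathrm{tw}(H)\ge t-1$. \end{itemize} -/

import Mathlib

/-- A tree decomposition of `G`: a finite tree `T` on `ι` with a bag
`bag t` of vertices of `G` for every node `t`. -/
structure TreeDecomposition {V : Type*} (G : SimpleGraph V) (ι : Type) where
  T : SimpleGraph ι
  finite_nodes : Finite ι
  isTree : T.IsTree
  bag : ι → Set V
  /-- Every vertex of `G` lies in some bag. -/
  vertex_mem : ∀ v : V, ∃ t : ι, v ∈ bag t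
  /-- The two ends of every edge of `G` lie in a common bag. -/
  edge_mem : ∀ u v : V, G.Adj u v → ∃ t : ι, u ∈ bag t ∧ v ∈ bag t
  /-- The nodes whose bags contain a given vertex induce a subtree of `T`. -/
  subtree : ∀ v : V, (T.induce {t : ι | v ∈ bag t}).Preconnected

/-- The width of a tree decomposition: maximum size of a bag, minus one. -/
noncomputable def TreeDecomposition.width {V : Type*} {G : SimpleGraph V} {ι : Type}
    (D : TreeDecomposition G ι) : ℕ∞ :=
  (⨆ t : ι, (D.bag t).encard) - 1

/-- The treewidth: the minimum width of a tree decomposition. It is the usual one for graphs with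
at least one vertex (the graph without vertices gets `0` here). -/
noncomputable def treewidth {V : Type*} (G : SimpleGraph V) : ℕ∞ :=
  ⨅ (ι : Type) (D : TreeDecomposition G ι), D.width

/-- Slow functions on the positive integers. The value at `0` is irrelevant and never used. -/
structure IsSlow (f : ℕ → ℕ) : Prop where
  one : f 1 = 1
  two : f 2 = 2
  three : f 3 = 3
  mono : ∀ i : ℕ, 1 ≤ i → f i ≤ f (i + 1)
  step : ∀ i : ℕ, 1 ≤ i → f (i + 1) ≤ f i + 1

/-- The cumulative function `F` of `f`: `F k = sup {i ≥ 1 | f i ≤ k}`, possibly infinite. -/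
noncomputable def cumulative (f : ℕ → ℕ) (k : ℕ) : ℕ∞ :=
  sSup {n : ℕ∞ | ∃ i : ℕ, 1 ≤ i ∧ f i ≤ k ∧ n = (i : ℕ∞)}

namespace LayeredWheel

/-- A layer of the wheel: a directed cycle on the positions `0 → 1 → ⋯ → size - 1 → 0`, together
with, for each position, the list `up` of the neighbours of that vertex in the previous layers.
A vertex is written as the pair (number of its layer, its position in that layer), and `up` lists
the neighbours by increasing layer. -/
structure Layer where
  size : ℕ
  up : Fin size → List (ℕ × ℕ)

/-- The number `n_v` of vertices of the path `L(v)`, for `v` with upper neighbours `N`, where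
`m = f (i + 1) - 1` and `v` is in layer `i`. -/
def pathLength (m ℓ : ℕ) (N : List (ℕ × ℕ)) : ℕ :=
  if N.length < m then ℓ - 2 else m * (ℓ - 2)

/-- The upper neighbours of the `j`-th vertex (counted from `0`) of the path `L(v)`, for `v` with
upper neighbours `N`, where `m = f (i + 1) - 1` and `v` is in layer `i`. If `N` has less than `m`
elements, they are `N ∪ {v}` for the first vertex of the path. Otherwise, they are
`(N \ {w}) ∪ {v}` for the first vertex of the `a`-th block of `ℓ - 2` vertices of the path,
where `w` is the `a`-th element of `N`. All other vertices of the path have none. -/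
def pathUp (m ℓ : ℕ) (v : ℕ × ℕ) (N : List (ℕ × ℕ)) (j : ℕ) : List (ℕ × ℕ) :=
  if j % (ℓ - 2) = 0 then
    (if N.length < m then N else N.eraseIdx (j / (ℓ - 2))) ++ [v]
  else []

/-- The layer `i + 1` built from the layer `i`, where `m = f (i + 1) - 1`: the concatenation of the
paths `L(v)` for `v` running through layer `i` in order (`finSigmaFinEquiv` is the lexicographic
enumeration of the pairs (position of `v`, index in the path `L(v)`)). -/
def nextLayer (m ℓ i : ℕ) (L : Layer) : Layer where
  size := ∑ p : Fin L.size, pathLength m ℓ (L.up p)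
  up x :=
    let y := finSigmaFinEquiv.symm x
    pathUp m ℓ (i, (y.1 : ℕ)) (L.up y.1) (y.2 : ℕ)

/-- The layers `L_1, L_2, …` of the `(f, ℓ)`-layered wheel. There is no layer `0`, so it is set to
be empty. -/
def layer (f : ℕ → ℕ) (ℓ : ℕ) : ℕ → Layer
  | 0 => ⟨0, fun _ => []⟩
  | 1 => ⟨ℓ, fun _ => []⟩
  | i + 2 => nextLayer (f (i + 2) - 1) ℓ (i + 1) (layer f ℓ (i + 1))

/-- The vertices of the `(f, ℓ)`-layered wheel: number of the layer, and position in it. -/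
abbrev Vertex (f : ℕ → ℕ) (ℓ : ℕ) : Type :=
  (i : ℕ) × Fin (layer f ℓ i).size

/-- The arcs `u → v` of the `(f, ℓ)`-layered wheel: either `v` follows `u` on the directed cycle
of their common layer, or `u` is an upper neighbour of `v`. -/
def Arc (f : ℕ → ℕ) (ℓ : ℕ) (u v : Vertex f ℓ) : Prop :=
  (u.1 = v.1 ∧ (v.2 : ℕ) = ((u.2 : ℕ) + 1) % (layer f ℓ u.1).size) ∨
    (u.1, (u.2 : ℕ)) ∈ (layer f ℓ v.1).up v.2

end LayeredWheel

/-- The (underlying undirected graph of the) `(f, ℓ)`-layered wheel. -/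
def layeredWheel (f : ℕ → ℕ) (ℓ : ℕ) : SimpleGraph (LayeredWheel.Vertex f ℓ) :=
  SimpleGraph.fromRel (LayeredWheel.Arc f ℓ)

/-! Upper bound. Let `k` be the clique number of `X` and `N = F(k+1)`. The upper neighbours of a
vertex form a clique, so at most `k` of them lie in `X`. When the next layer has number above `N`, a
full list of upper neighbours has at least `k+1` entries, hence one outside `X`, and some child
drops exactly that one: this child keeps the vertex and all its upper neighbours in `X`. Following
such children gives a "wall" crossing the layers. Its elements in `X` beyond the first `N` layers
are all upper neighbours of one vertex far up, so there are at most `k` of them. With the upper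
neighbours of its first vertex, a wall has at most `M = N + 2k` elements (`encard_own_le`). Walls
from different vertices do not cross, because the parent map is monotone; in the universal cover,
where each cycle becomes the integers, "between two walls" makes sense. Two walls and a set of at
most `2M` upper neighbours separate the part of `X` in between. Cutting recursively along a third
wall gives bags of size at most `5M` (`hasDecomposition_region`), and `5M - 1` is below the stated
bound.

Lower bound. The first `T` layers are connected and pairwise adjacent, so they form a clique minor,
and by the Helly property some bag meets all of them. Their clique number is `f T`
(`cliqueNum_firstLayers`), and `T` is chosen with `f T = k`. -/

/-! ### Helly property of subtrees of a tree -/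

section Helly

/-- In a graph, a set of nodes containing all paths between its elements. -/
def PathConvex {ι : Type*} (T : SimpleGraph ι) (A : Set ι) : Prop :=
  ∀ ⦃u v : ι⦄, u ∈ A → v ∈ A → ∀ p : T.Walk u v, p.IsPath → ∀ x ∈ p.support, x ∈ A

theorem PathConvex.inter {ι : Type*} {T : SimpleGraph ι} {A B : Set ι}
    (hA : PathConvex T A) (hB : PathConvex T B) : PathConvex T (A ∩ B) :=
  fun _ _ hu hv p hp x hx => ⟨hA hu.1 hv.1 p hp x hx, hB hu.2 hv.2 p hp x hx⟩

/-- In a forest the path between two nodes is unique, so the one found inside `A` is the given one.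
-/
theorem PathConvex.of_preconnected {ι : Type*} {T : SimpleGraph ι} (hT : T.IsAcyclic) {A : Set ι}
    (hA : (T.induce A).Preconnected) : PathConvex T A := by
  classical
  intro u v hu hv p hp x hx
  obtain ⟨q⟩ := hA ⟨u, hu⟩ ⟨v, hv⟩
  let q' : T.Walk u v := q.map (SimpleGraph.Embedding.induce A).toHom
  have h : (⟨p, hp⟩ : T.Path u v) = q'.toPath := (hT.subsingleton_path u v).elim _ _
  have hx' : x ∈ q'.support := by
    apply SimpleGraph.Walk.support_toPath_subset_support q'
    rw [← h]
    exact hx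
  have hsupp : q'.support = q.support.map (SimpleGraph.Embedding.induce A).toHom :=
    SimpleGraph.Walk.support_map _ _
  rw [hsupp, List.mem_map] at hx'
  obtain ⟨y, -, rfl⟩ := hx'
  exact y.2

/-- Walk from `A ∩ B` to `A ∩ C` inside `A`. The last vertex of `B` on the way lies on the path from
`A ∩ C` to `B ∩ C`, hence in `C`. -/
theorem PathConvex.inter_inter_nonempty {ι : Type*} {T : SimpleGraph ι} (hT : T.IsTree)
    {A B C : Set ι} (hA : PathConvex T A) (hB : PathConvex T B) (hC : PathConvex T C)
    (hAB : (A ∩ B).Nonempty) (hBC : (B ∩ C).Nonempty) (hAC : (A ∩ C).Nonempty) :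
    (A ∩ B ∩ C).Nonempty := by
  classical
  obtain ⟨y, hyB, hyC⟩ := hBC
  obtain ⟨z, hzA, hzC⟩ := hAC
  obtain ⟨x, hxA, hxB⟩ := hAB
  suffices H : ∀ (x z : ι) (p : T.Walk x z), p.IsPath → x ∈ A → x ∈ B → z ∈ A → z ∈ C →
      (A ∩ B ∩ C).Nonempty by
    obtain ⟨p, hp, -⟩ := hT.existsUnique_path x z
    exact H x z p hp hxA hxB hzA hzC
  intro x z p
  induction p with
  | nil => intro _ h1 h2 _ h3; exact ⟨_, ⟨h1, h2⟩, h3⟩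
  | @cons x w z h p ih =>
    intro hp hxA hxB hzA hzC
    have hpp := hp.of_cons
    have hwA : w ∈ A := hA hxA hzA _ hp w (by simp)
    by_cases hw : ∃ w' ∈ p.support, w' ∈ B
    · by_cases hwB : w ∈ B
      · exact ih hpp hwA hwB hzA hzC
      · exfalso
        obtain ⟨w', hw', hw'B⟩ := hw
        apply hwB
        have := hp.takeUntil (u := w') (by simp [hw'])
        refine hB hxB hw'B _ this w ?_
        have hne : x ≠ w' := by
          rintro rfl
          exact (SimpleGraph.Walk.cons_isPath_iff h p).1 hp |>.2 hw'
        rw [SimpleGraph.Walk.takeUntil_cons hw' hne]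
        simp
    · push Not at hw
      refine ⟨x, ⟨hxA, hxB⟩, ?_⟩
      obtain ⟨q, hq, -⟩ := hT.existsUnique_path x y
      have hqB : ∀ s ∈ q.support, s ∈ B := hB hxB hyB q hq
      have hpath : ((SimpleGraph.Walk.cons h p).reverse.append q).IsPath := by
        -- The two pieces meet only at `x`: `q` stays in `B`, while `p` avoids `B`.
        rw [SimpleGraph.Walk.isPath_def, SimpleGraph.Walk.support_append]
        refine List.Nodup.append ?_ ?_ ?_
        · exact hp.reverse.support_nodup
        · exact hq.support_nodup.tail
        · intro s hs hs'
          simp only [SimpleGraph.Walk.support_reverse, List.mem_reverse,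
            SimpleGraph.Walk.support_cons, List.mem_cons] at hs
          rcases hs with rfl | hs
          · have := hq.support_nodup
            rw [← SimpleGraph.Walk.cons_tail_support] at this
            exact (List.nodup_cons.1 this).1 hs'
          · exact hw s hs (hqB s (List.mem_of_mem_tail hs'))
      refine hC hzC hyC _ hpath x ?_
      rw [SimpleGraph.Walk.mem_support_append_iff]
      right
      simp

/-- The Helly property of subtrees. -/
theorem PathConvex.helly {ι κ : Type*} {T : SimpleGraph ι} (hT : T.IsTree) (s : Finset κ) :
    ∀ A : κ → Set ι, (∀ i ∈ s, PathConvex T (A i)) →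
      (∀ i ∈ s, ∀ j ∈ s, (A i ∩ A j).Nonempty) → ∃ t, ∀ i ∈ s, t ∈ A i := by
  classical
  induction s using Finset.induction_on with
  | empty =>
    intro A _ _
    obtain ⟨t⟩ := hT.connected.nonempty
    exact ⟨t, by simp⟩
  | insert a s ha ih =>
    intro A hc hi
    rcases s.eq_empty_or_nonempty with rfl | ⟨b, hb⟩
    · obtain ⟨t, ht, -⟩ := hi a (by simp) a (by simp)
      exact ⟨t, by simpa using ht⟩
    -- The sets `A a ∩ A i` still intersect pairwise, by the case of three sets.
    · obtain ⟨t, ht⟩ := ih (fun i => A a ∩ A i)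
        (fun i hi => (hc a (by simp)).inter (hc i (by simp [hi]))) (fun i hi' j hj => by
          have := PathConvex.inter_inter_nonempty hT (hc a (by simp)) (hc i (by simp [hi']))
            (hc j (by simp [hj])) (hi _ (by simp) _ (by simp [hi']))
            (hi _ (by simp [hi']) _ (by simp [hj])) (hi _ (by simp) _ (by simp [hj]))
          obtain ⟨t, ⟨h1, h2⟩, h3⟩ := this
          exact ⟨t, ⟨h1, h2⟩, h1, h3⟩)
      refine ⟨t, fun i hi => ?_⟩
      rcases Finset.mem_insert.1 hi with rfl | hi
      · exact (ht b hb).1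
      · exact (ht i hi).2

end Helly

/-! ### Clique minors bound the treewidth from below -/

section LowerBound

/-- The nodes of a tree decomposition whose bags meet a connected set induce a subtree. -/
theorem TreeDecomposition.preconnected_meets {V : Type*} {G : SimpleGraph V} {ι : Type}
    (D : TreeDecomposition G ι) (A : Set V)
    (hA : ∀ u ∈ A, ∀ v ∈ A, Relation.ReflTransGen (fun x y => G.Adj x y ∧ y ∈ A) u v) :
    (D.T.induce {t | ∃ u ∈ A, u ∈ D.bag t}).Preconnected := by
  have same : ∀ u ∈ A, ∀ t t' (ht : t ∈ {t | ∃ u ∈ A, u ∈ D.bag t})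
      (ht' : t' ∈ {t | ∃ u ∈ A, u ∈ D.bag t}), u ∈ D.bag t → u ∈ D.bag t' →
      (D.T.induce {t | ∃ u ∈ A, u ∈ D.bag t}).Reachable ⟨t, ht⟩ ⟨t', ht'⟩ := by
    intro u hu t t' ht ht' h h'
    have hsub : {t | u ∈ D.bag t} ⊆ {t | ∃ u ∈ A, u ∈ D.bag t} := fun s hs => ⟨u, hu, hs⟩
    have := D.subtree u ⟨t, h⟩ ⟨t', h'⟩
    exact this.map (SimpleGraph.induceHomOfLE D.T hsub).toHom
  rintro ⟨t, u, hu, hut⟩ ⟨t', v, hv, hvt'⟩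
  have h := hA u hu v hv
  induction h generalizing t' with
  | refl => exact same u hu _ _ _ _ hut hvt'
  | @tail w v hw hwv ih =>
    obtain ⟨s, hws, hvs⟩ := D.edge_mem w v hwv.1
    have hwA : w ∈ A := by
      rcases hw.cases_tail with h | ⟨_, _, h⟩
      · rw [h]; exact hu
      · exact h.2
    exact (ih s hwA hws).trans (same v hv _ _ _ _ hvs hvt')

/-- Pairwise disjoint, connected and pairwise adjacent sets of vertices (a clique minor) bound
the treewidth from below. -/
theorem card_sub_one_le_treewidth {V κ : Type*} {G : SimpleGraph V} (s : Finset κ) (A : κ → Set V)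
    (hdisj : ∀ i ∈ s, ∀ j ∈ s, ∀ v, v ∈ A i → v ∈ A j → i = j)
    (hconn : ∀ i ∈ s, ∀ u ∈ A i, ∀ v ∈ A i,
      Relation.ReflTransGen (fun x y => G.Adj x y ∧ y ∈ A i) u v)
    (hne : ∀ i ∈ s, (A i).Nonempty)
    (hadj : ∀ i ∈ s, ∀ j ∈ s, i ≠ j → ∃ u ∈ A i, ∃ v ∈ A j, G.Adj u v) :
    (s.card : ℕ∞) - 1 ≤ treewidth G := by
  classical
  refine le_iInf₂ fun ι D => ?_
  obtain ⟨t, ht⟩ := PathConvex.helly D.isTree s (fun i => {t | ∃ u ∈ A i, u ∈ D.bag t})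
    (fun i hi => PathConvex.of_preconnected D.isTree.isAcyclic
      (D.preconnected_meets (A i) (hconn i hi))) (by
      intro i hi j hj
      by_cases hij : i = j
      · subst hij
        obtain ⟨u, hu⟩ := hne i hi
        obtain ⟨t, ht⟩ := D.vertex_mem u
        exact ⟨t, ⟨u, hu, ht⟩, ⟨u, hu, ht⟩⟩
      · obtain ⟨u, hu, v, hv, huv⟩ := hadj i hi j hj hij
        obtain ⟨t, h1, h2⟩ := D.edge_mem u v huv
        exact ⟨t, ⟨u, hu, h1⟩, ⟨v, hv, h2⟩⟩)
  -- The bag at `t` meets every branch set; disjointness makes the chosen representatives distinct.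
  have hcard : (s.card : ℕ∞) ≤ (D.bag t).encard := by
    rcases s.eq_empty_or_nonempty with rfl | ⟨i, hi⟩
    · simp
    have : Nonempty V := (hne i hi).to_type
    choose! g hg using ht
    rw [← Set.encard_coe_eq_coe_finsetCard]
    refine Set.encard_le_encard_of_injOn (f := g) (fun i hi => (hg i hi).2) ?_
    intro i hi j hj hij
    exact hdisj i hi j hj (g i) (hg i hi).1 (hij ▸ (hg j hj).1)
  exact tsub_le_tsub_right (hcard.trans (le_iSup (fun t => (D.bag t).encard) t)) 1

end LowerBound

/-! ### Gluing rooted tree decompositions -/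

section Gluing

/-- No edge joins the two summands. The endpoint is left general, with an equation, so that
induction on the walk applies. -/
theorem SimpleGraph.Walk.exists_map_inl {V W : Type*} {G : SimpleGraph V} {H : SimpleGraph W}
    {a b : V ⊕ W} (p : (G ⊕g H).Walk a b) : ∀ v (h : a = Sum.inl v), ∃ v', ∃ h' : b = Sum.inl v',
      ∃ q : G.Walk v v',
        p = (q.map (SimpleGraph.Embedding.sumInl (H := H)).toHom).copy h.symm h'.symm := by
  induction p with
  | nil => rintro v rfl; exact ⟨v, rfl, SimpleGraph.Walk.nil, rfl⟩
  | @cons a c b h p ih =>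
    rintro v rfl
    rcases c with c | c
    · obtain ⟨v', rfl, q, rfl⟩ := ih c rfl
      exact ⟨v', rfl, SimpleGraph.Walk.cons (by simpa using h) q, rfl⟩
    · simp at h

theorem SimpleGraph.IsAcyclic.not_isCycle_inl {V W : Type*} {G : SimpleGraph V}
    {H : SimpleGraph W} (hG : G.IsAcyclic) {a : V ⊕ W} (v : V) (ha : a = Sum.inl v)
    (c : (G ⊕g H).Walk a a) : ¬ c.IsCycle := by
  intro hc
  subst ha
  obtain ⟨v', h', q, hq⟩ := c.exists_map_inl v rfl
  obtain rfl := Sum.inl_injective h'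
  subst hq
  have hc' : (q.map (SimpleGraph.Embedding.sumInl (H := H)).toHom).IsCycle := hc
  exact hG q ((SimpleGraph.Walk.isCycle_map_iff_of_injective Sum.inl_injective).1 hc')

theorem SimpleGraph.IsAcyclic.sum {V W : Type*} {G : SimpleGraph V} {H : SimpleGraph W}
    (hG : G.IsAcyclic) (hH : H.IsAcyclic) : (G ⊕g H).IsAcyclic := by
  rintro (v | w) c hc
  · exact hG.not_isCycle_inl v rfl c hc
  · refine hH.not_isCycle_inl w rfl (c.map (SimpleGraph.Iso.sumComm (G := G) (H := H)).toHom) ?_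
    exact (SimpleGraph.Walk.isCycle_map_iff_of_injective
      (SimpleGraph.Iso.sumComm (G := G) (H := H)).injective).2 hc

theorem SimpleGraph.IsTree.sum_sup_edge {V W : Type*} {G : SimpleGraph V} {H : SimpleGraph W}
    (hG : G.IsTree) (hH : H.IsTree) (v : V) (w : W) :
    ((G ⊕g H) ⊔ SimpleGraph.edge (Sum.inl v) (Sum.inr w)).IsTree :=
  ⟨hG.connected.sum_sup_edge hH.connected,
    (hG.isAcyclic.sum hH.isAcyclic).sup_edge_of_not_reachable
      (SimpleGraph.not_reachable_sum_inl_inr v w)⟩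

/-- The subgraph of `G` induced by `A` has a tree decomposition with bags of size at most `w`, one
of which contains `S`. -/
def HasDecomposition {V : Type*} (G : SimpleGraph V) (w : ℕ∞) (A S : Set V) : Prop :=
  ∃ (ι : Type) (T : SimpleGraph ι) (bag : ι → Set V) (r : ι),
    Finite ι ∧ T.IsTree ∧ (∀ t, bag t ⊆ A) ∧ S ⊆ bag r ∧ (∀ v ∈ A, ∃ t, v ∈ bag t) ∧
    (∀ u ∈ A, ∀ v ∈ A, G.Adj u v → ∃ t, u ∈ bag t ∧ v ∈ bag t) ∧
    (∀ v, (T.induce {t | v ∈ bag t}).Preconnected) ∧ ∀ t, (bag t).encard ≤ w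

theorem HasDecomposition.single {V : Type*} {G : SimpleGraph V} {w : ℕ∞} {B : Set V}
    (hB : B.encard ≤ w) : HasDecomposition G w B B := by
  refine ⟨Unit, ⊥, fun _ => B, (), inferInstance, SimpleGraph.IsTree.of_subsingleton,
    fun _ => subset_rfl, subset_rfl, fun v hv => ⟨(), hv⟩, fun u hu v hv _ => ⟨(), hu, hv⟩, ?_,
    fun _ => hB⟩
  rintro v ⟨a, ha⟩ ⟨b, hb⟩
  exact SimpleGraph.Reachable.refl _

theorem HasDecomposition.mono {V : Type*} {G : SimpleGraph V} {w : ℕ∞} {A S A' S' : Set V}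
    (h : HasDecomposition G w A S) (hA : A' ⊆ A) (hS : S' ⊆ S) (hSA : S' ⊆ A') :
    HasDecomposition G w A' S' := by
  obtain ⟨ι, T, bag, r, hfin, hT, -, hr, hv, he, hsub, hw⟩ := h
  refine ⟨ι, T, fun t => bag t ∩ A', r, hfin, hT, fun t => Set.inter_subset_right,
    Set.subset_inter (hS.trans hr) hSA, ?_, ?_, ?_, ?_⟩
  · intro v hv'
    obtain ⟨t, ht⟩ := hv v (hA hv')
    exact ⟨t, ht, hv'⟩
  · intro u hu v hv' huv
    obtain ⟨t, h1, h2⟩ := he u (hA hu) v (hA hv') huv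
    exact ⟨t, ⟨h1, hu⟩, ⟨h2, hv'⟩⟩
  · intro v
    by_cases hv' : v ∈ A'
    · have heq : {t | v ∈ bag t ∩ A'} = {t | v ∈ bag t} := by ext t; simp [hv']
      rw [heq]
      exact hsub v
    · rintro ⟨a, ha⟩
      exact absurd ha.2 hv'
  · exact fun t => (Set.encard_le_encard Set.inter_subset_left).trans (hw t)

/-- Attaching a decomposition along a subset of the root bag. -/
theorem HasDecomposition.glue {V : Type*} {G : SimpleGraph V} {w : ℕ∞} {A S C S' : Set V}
    (h : HasDecomposition G w A S) (h' : HasDecomposition G w (S' ∪ C) S') (hS : S' ⊆ S)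
    (hAC : Disjoint A C) (hadj : ∀ u ∈ C, ∀ v ∈ A, G.Adj u v → v ∈ S') :
    HasDecomposition G w (A ∪ C) S := by
  obtain ⟨ι, T, bag, r, hfin, hT, hbA, hr, hv, he, hsub, hw⟩ := h
  obtain ⟨ι', T', bag', r', hfin', hT', hbA', hr', hv', he', hsub', hw'⟩ := h'
  have hSA : S' ⊆ A := (hS.trans hr).trans (hbA r)
  refine ⟨ι ⊕ ι', (T ⊕g T') ⊔ SimpleGraph.edge (Sum.inl r) (Sum.inr r'), Sum.elim bag bag',
    Sum.inl r, inferInstance, hT.sum_sup_edge hT' r r', ?_, hr, ?_, ?_, ?_, ?_⟩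
  · rintro (t | t)
    · exact (hbA t).trans Set.subset_union_left
    · exact (hbA' t).trans (Set.union_subset_union_left _ hSA)
  · rintro v (hvA | hvC)
    · obtain ⟨t, ht⟩ := hv v hvA
      exact ⟨Sum.inl t, ht⟩
    · obtain ⟨t, ht⟩ := hv' v (Or.inr hvC)
      exact ⟨Sum.inr t, ht⟩
  · rintro u hu v hv'' huv
    have right : u ∈ S' ∪ C → v ∈ S' ∪ C →
        ∃ t, u ∈ Sum.elim bag bag' t ∧ v ∈ Sum.elim bag bag' t := by
      intro h1 h2
      obtain ⟨t, h1, h2⟩ := he' u h1 v h2 huv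
      exact ⟨Sum.inr t, h1, h2⟩
    rcases hu with hu | hu <;> rcases hv'' with hv'' | hv''
    · obtain ⟨t, h1, h2⟩ := he u hu v hv'' huv
      exact ⟨Sum.inl t, h1, h2⟩
    · exact right (Or.inl (hadj v hv'' u hu huv.symm)) (Or.inr hv'')
    · exact right (Or.inr hu) (Or.inl (hadj u hu v hv'' huv))
    · exact right (Or.inr hu) (Or.inr hv'')
  · intro v
    set U := (T ⊕g T') ⊔ SimpleGraph.edge (Sum.inl r) (Sum.inr r')
    have hl : ∀ a b (ha : v ∈ bag a) (hb : v ∈ bag b),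
        (U.induce {t | v ∈ Sum.elim bag bag' t}).Reachable ⟨Sum.inl a, ha⟩ ⟨Sum.inl b, hb⟩ := by
      intro a b ha hb
      exact (hsub v ⟨a, ha⟩ ⟨b, hb⟩).map (⟨fun t => ⟨Sum.inl t.1, t.2⟩, by
          rintro ⟨x, hx⟩ ⟨y, hy⟩ hxy
          simp only [SimpleGraph.comap_adj, Function.Embedding.subtype_apply] at hxy ⊢
          exact Or.inl (by simpa using hxy)⟩ :
          T.induce {t | v ∈ bag t} →g U.induce {t | v ∈ Sum.elim bag bag' t})
    have hr2 : ∀ a b (ha : v ∈ bag' a) (hb : v ∈ bag' b),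
        (U.induce {t | v ∈ Sum.elim bag bag' t}).Reachable ⟨Sum.inr a, ha⟩ ⟨Sum.inr b, hb⟩ := by
      intro a b ha hb
      exact (hsub' v ⟨a, ha⟩ ⟨b, hb⟩).map (⟨fun t => ⟨Sum.inr t.1, t.2⟩, by
          rintro ⟨x, hx⟩ ⟨y, hy⟩ hxy
          simp only [SimpleGraph.comap_adj, Function.Embedding.subtype_apply] at hxy ⊢
          exact Or.inl (by simpa using hxy)⟩ :
          T'.induce {t | v ∈ bag' t} →g U.induce {t | v ∈ Sum.elim bag bag' t})
    -- A vertex with bags on both sides lies in `S'`, since `A` and `C` are disjoint. It is thus in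
    -- both root bags, which the new edge joins.
    have hlr : ∀ a b (ha : v ∈ bag a) (hb : v ∈ bag' b),
        (U.induce {t | v ∈ Sum.elim bag bag' t}).Reachable ⟨Sum.inl a, ha⟩ ⟨Sum.inr b, hb⟩ := by
      intro a b ha hb
      have hvS : v ∈ S' := by
        rcases hbA' b hb with h | h
        · exact h
        · exact absurd h (Set.disjoint_left.1 hAC (hbA a ha))
      have e : (U.induce {t | v ∈ Sum.elim bag bag' t}).Reachable
          ⟨Sum.inl r, hr (hS hvS)⟩ ⟨Sum.inr r', hr' hvS⟩ := by
        apply SimpleGraph.Adj.reachable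
        simp [U, SimpleGraph.edge_adj]
      exact ((hl a r ha (hr (hS hvS))).trans e).trans (hr2 r' b (hr' hvS) hb)
    rintro ⟨a | a, ha⟩ ⟨b | b, hb⟩
    · exact hl a b ha hb
    · exact hlr a b ha hb
    · exact (hlr b a hb ha).symm
    · exact hr2 a b ha hb
  · rintro (t | t)
    · exact hw t
    · exact hw' t

theorem HasDecomposition.treewidth_le {V : Type*} {G : SimpleGraph V} {w : ℕ∞} {A S : Set V}
    (h : HasDecomposition G w A S) : treewidth (G.induce A) ≤ w - 1 := by
  obtain ⟨ι, T, bag, r, hfin, hT, -, -, hv, he, hsub, hw⟩ := h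
  let D : TreeDecomposition (G.induce A) ι :=
    { T := T
      finite_nodes := hfin
      isTree := hT
      bag := fun t => Subtype.val ⁻¹' bag t
      vertex_mem := fun v => hv v.1 v.2
      edge_mem := fun u v huv => he u.1 u.2 v.1 v.2 huv
      subtree := fun v => hsub v.1 }
  refine (iInf₂_le ι D).trans (tsub_le_tsub_right (iSup_le fun t => ?_) 1)
  have h : (Subtype.val ⁻¹' bag t : Set A).encard ≤ (bag t).encard :=
    Set.encard_le_encard_of_injOn (f := Subtype.val) (fun x hx => hx) Subtype.val_injective.injOn
  exact h.trans (hw t)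

end Gluing

/-! ### Walls and separators in the universal cover -/

/-- A universal cover, layer by layer, of a graph `G` made of cyclic layers: layer `i` is covered by
the integers, `par i` maps layer `i + 1` to layer `i` monotonically, and `next i` chooses a child of
every vertex of layer `i`. The relation `Up z v` means that `z` is an upper neighbour of `v`. -/
structure LayerCover {V : Type*} (G : SimpleGraph V) where
  pos : ℕ → ℤ → V
  par : ℕ → ℤ → ℤ
  next : ℕ → ℤ → ℤ
  per : ℕ → ℤ
  Up : V → V → Prop
  per_pos : ∀ i, 0 < per i
  pos_eq_iff : ∀ i n j m, pos i n = pos j m ↔ i = j ∧ per i ∣ n - m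
  exists_pos : ∀ v, ∃ i n, v = pos i n
  par_mono : ∀ i, Monotone (par i)
  par_add_per : ∀ i n, par i (n + per (i + 1)) = par i n + per i
  next_add_per : ∀ i n, next i (n + per i) = next i n + per (i + 1)
  par_next : ∀ i n, par i (next i n) = n
  not_up_zero : ∀ z n, ¬ Up z (pos 0 n)
  up_succ : ∀ z i n, Up z (pos (i + 1) n) → z = pos i (par i n) ∨ Up z (pos i (par i n))
  adj : ∀ j n z, G.Adj (pos j n) z →
    z = pos j (n + 1) ∨ z = pos j (n - 1) ∨ Up z (pos j n) ∨ Up (pos j n) z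

namespace LayerCover

variable {V : Type*} {G : SimpleGraph V} (K : LayerCover G)

theorem par_add_mul_per (i : ℕ) (n q : ℤ) :
    K.par i (n + q * K.per (i + 1)) = K.par i n + q * K.per i := by
  induction q using Int.induction_on with
  | zero => simp
  | succ q ih =>
    rw [show n + ((q : ℤ) + 1) * K.per (i + 1) = n + q * K.per (i + 1) + K.per (i + 1) by ring,
      K.par_add_per, ih]
    ring
  | pred q ih =>
    have := K.par_add_per i (n + (-(q : ℤ) - 1) * K.per (i + 1))
    rw [show n + (-(q : ℤ) - 1) * K.per (i + 1) + K.per (i + 1) = n + -(q : ℤ) * K.per (i + 1) by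
      ring, ih] at this
    linarith

/-- A position may represent its parent's vertex in the wrong period; translating by whole periods
corrects this. -/
theorem exists_lift {i : ℕ} {m n : ℤ} (h : K.pos i (K.par i m) = K.pos i n) :
    ∃ m', K.pos (i + 1) m' = K.pos (i + 1) m ∧ K.par i m' = n := by
  obtain ⟨q, hq⟩ := ((K.pos_eq_iff _ _ _ _).1 h).2
  refine ⟨m + (-q) * K.per (i + 1), ?_, ?_⟩
  · rw [K.pos_eq_iff]
    exact ⟨rfl, -q, by ring⟩
  · rw [K.par_add_mul_per]
    linarith

/-- Forced by monotonicity of the parent map, to which `next` is a section. This is why walls never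
cross. -/
theorem next_strictMono (i : ℕ) : StrictMono (K.next i) := by
  intro a b hab
  by_contra h
  have := K.par_mono i (not_lt.1 h)
  rw [K.par_next, K.par_next] at this
  omega

/-- The position in layer `j` of the wall that starts at position `a` in layer `i` and always
continues with the chosen child. -/
def wall (i : ℕ) : ℕ → ℤ → ℤ
  | 0, a => a
  | j + 1, a => if i ≤ j then K.next j (wall i j a) else a

theorem wall_of_le {i j : ℕ} (h : j ≤ i) (a : ℤ) : K.wall i j a = a := by
  cases j with
  | zero => rfl
  | succ j => rw [wall, if_neg (by omega)]

theorem wall_succ {i j : ℕ} (h : i ≤ j) (a : ℤ) :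
    K.wall i (j + 1) a = K.next j (K.wall i j a) := by
  rw [wall, if_pos h]

theorem wall_next {i j : ℕ} (h : i + 1 ≤ j) (a : ℤ) :
    K.wall (i + 1) j (K.next i a) = K.wall i j a := by
  induction j, h using Nat.le_induction with
  | base => rw [K.wall_of_le le_rfl, K.wall_succ le_rfl, K.wall_of_le le_rfl]
  | succ j hj ih => rw [K.wall_succ hj, K.wall_succ (by omega), ih]

theorem wall_strictMono (i j : ℕ) : StrictMono (K.wall i j) := by
  induction j with
  | zero => exact fun _ _ h => h
  | succ j ih =>
    intro a b hab
    by_cases h : i ≤ j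
    · rw [K.wall_succ h, K.wall_succ h]
      exact K.next_strictMono j (ih hab)
    · rwa [K.wall_of_le (by omega), K.wall_of_le (by omega)]

theorem wall_add_per {i j : ℕ} (h : i ≤ j) (a : ℤ) :
    K.wall i j (a + K.per i) = K.wall i j a + K.per j := by
  induction j, h using Nat.le_induction with
  | base => rw [K.wall_of_le le_rfl, K.wall_of_le le_rfl]
  | succ j hj ih => rw [K.wall_succ hj, K.wall_succ hj, ih, K.next_add_per]

theorem par_wall_succ {i j : ℕ} (h : i ≤ j) (a : ℤ) :
    K.par j (K.wall i (j + 1) a) = K.wall i j a := by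
  rw [K.wall_succ h, K.par_next]

/-- The vertices in layers `≥ i` strictly between the walls from the positions `a` and `b` of
layer `i`. -/
def region (i : ℕ) (a b : ℤ) : Set V :=
  {v | ∃ j n, i ≤ j ∧ v = K.pos j n ∧ K.wall i j a < n ∧ n < K.wall i j b}

/-- The elements of `X` that are on the wall from the position `a` of layer `i`, or are upper
neighbours of its first vertex. -/
def own (X : Set V) (i : ℕ) (a : ℤ) : Set V :=
  {v | v ∈ X ∧ (K.Up v (K.pos i a) ∨ ∃ j, i ≤ j ∧ v = K.pos j (K.wall i j a))}

theorem exists_of_up {z : V} {j : ℕ} {n : ℤ} (h : K.Up z (K.pos j n)) :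
    ∃ i m, i < j ∧ z = K.pos i m := by
  induction j generalizing n with
  | zero => exact absurd h (K.not_up_zero z n)
  | succ j ih =>
    rcases K.up_succ _ _ _ h with h | h
    · exact ⟨j, _, by omega, h⟩
    · obtain ⟨i, m, hi, hm⟩ := ih h
      exact ⟨i, m, by omega, hm⟩

/-- Upper neighbours of a child are its parent or upper neighbours of the parent, so starting the
wall one layer later adds nothing. -/
theorem own_next_subset (X : Set V) (i : ℕ) (a : ℤ) :
    K.own X (i + 1) (K.next i a) ⊆ K.own X i a := by
  rintro v ⟨hv, h | ⟨j, hj, h⟩⟩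
  · refine ⟨hv, ?_⟩
    rcases K.up_succ _ _ _ h with h | h <;> rw [K.par_next] at h
    · exact Or.inr ⟨i, le_rfl, by rwa [K.wall_of_le le_rfl]⟩
    · exact Or.inl h
  · exact ⟨hv, Or.inr ⟨j, by omega, by rwa [K.wall_next hj] at h⟩⟩

theorem mem_of_between {X : Set V} {i j : ℕ} {a b n : ℤ} (hij : i ≤ j) (ha : K.wall i j a ≤ n)
    (hb : n ≤ K.wall i j b) (hX : K.pos j n ∈ X) :
    K.pos j n ∈ K.region i a b ∪ (K.own X i a ∪ K.own X i b) := by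
  rcases ha.eq_or_lt with rfl | ha
  · exact Or.inr (Or.inl ⟨hX, Or.inr ⟨j, hij, rfl⟩⟩)
  rcases hb.eq_or_lt with rfl | hb
  · exact Or.inr (Or.inr ⟨hX, Or.inr ⟨j, hij, rfl⟩⟩)
  exact Or.inl ⟨j, n, hij, rfl, ha, hb⟩

/-- Going from vertex to parent stays weakly between the walls. An upper neighbour is met on the way
as a parent, or survives down to layer `i`, where `hS` puts it in `S₀`. -/
theorem up_mem_of_between {X S₀ : Set V} {i : ℕ} {a b : ℤ}
    (hS : ∀ c, a ≤ c → c ≤ b → ∀ z ∈ X, K.Up z (K.pos i c) → z ∈ S₀) {j : ℕ} (hij : i ≤ j)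
    {n : ℤ} (ha : K.wall i j a ≤ n) (hb : n ≤ K.wall i j b) {z : V} (hz : z ∈ X)
    (h : K.Up z (K.pos j n)) :
    z ∈ K.region i a b ∪ (S₀ ∪ (K.own X i a ∪ K.own X i b)) := by
  induction j, hij using Nat.le_induction generalizing n with
  | base =>
    rw [K.wall_of_le le_rfl] at ha hb
    exact Or.inr (Or.inl (hS n ha hb z hz h))
  | succ j hij ih =>
    have ha' := K.par_mono j ha
    have hb' := K.par_mono j hb
    rw [K.par_wall_succ hij] at ha' hb'
    rcases K.up_succ _ _ _ h with rfl | h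
    · rcases K.mem_of_between hij ha' hb' hz with h | h
      · exact Or.inl h
      · exact Or.inr (Or.inr h)
    · exact ih ha' hb' h

/-- The chain of parents from the upper vertex reaches the lower one. A vertex on or beyond a wall
would have its parent on or beyond that wall, so the whole chain stays strictly inside, after
lifting to the right period. -/
theorem region_of_up_aux {i j : ℕ} {a b n : ℤ} (hij : i ≤ j) (ha : K.wall i j a < n)
    (hb : n < K.wall i j b) {j' : ℕ} {m : ℤ} (h : K.Up (K.pos j n) (K.pos j' m)) :
    ∃ m', K.pos j' m' = K.pos j' m ∧ i ≤ j' ∧ K.wall i j' a < m' ∧ m' < K.wall i j' b := by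
  induction j' generalizing m with
  | zero => exact absurd h (K.not_up_zero _ _)
  | succ j' ih =>
    obtain ⟨p, hp, hij', hpa, hpb⟩ : ∃ p, K.pos j' p = K.pos j' (K.par j' m) ∧ i ≤ j' ∧
        K.wall i j' a < p ∧ p < K.wall i j' b := by
      rcases K.up_succ _ _ _ h with h | h
      · obtain ⟨rfl, -⟩ := (K.pos_eq_iff _ _ _ _).1 h
        exact ⟨n, h, hij, ha, hb⟩
      · exact ih h
    obtain ⟨m', hm', hpar⟩ := K.exists_lift hp.symm
    refine ⟨m', hm', by omega, ?_, ?_⟩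
    · by_contra hc
      have := K.par_mono j' (not_lt.1 hc)
      rw [K.par_wall_succ hij'] at this
      omega
    · by_contra hc
      have := K.par_mono j' (not_lt.1 hc)
      rw [K.par_wall_succ hij'] at this
      omega

theorem region_of_up {i : ℕ} {a b : ℤ} {u v : V} (hu : u ∈ K.region i a b) (h : K.Up u v) :
    v ∈ K.region i a b := by
  obtain ⟨j, n, hij, rfl, ha, hb⟩ := hu
  obtain ⟨j', m, rfl⟩ := K.exists_pos v
  obtain ⟨m', hm', hij', ha', hb'⟩ := K.region_of_up_aux hij ha hb h
  exact ⟨j', m', hij', hm'.symm, ha', hb'⟩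

/-- A region is separated from the rest of `X` by the two walls and the upper neighbours. -/
theorem mem_of_adj_region {X S₀ : Set V} {i : ℕ} {a b : ℤ}
    (hS : ∀ c, a ≤ c → c ≤ b → ∀ z ∈ X, K.Up z (K.pos i c) → z ∈ S₀) {y z : V}
    (hy : y ∈ K.region i a b) (hz : z ∈ X) (h : G.Adj y z) :
    z ∈ K.region i a b ∪ (S₀ ∪ (K.own X i a ∪ K.own X i b)) := by
  have hy' := hy
  obtain ⟨j, n, hij, rfl, ha, hb⟩ := hy
  have aux : ∀ m, K.wall i j a ≤ m → m ≤ K.wall i j b → K.pos j m ∈ X →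
      K.pos j m ∈ K.region i a b ∪ (S₀ ∪ (K.own X i a ∪ K.own X i b)) := by
    intro m h1 h2 h3
    rcases K.mem_of_between hij h1 h2 h3 with h | h
    · exact Or.inl h
    · exact Or.inr (Or.inr h)
  rcases K.adj _ _ _ h with rfl | rfl | h | h
  · exact aux _ (by omega) (by omega) hz
  · exact aux _ (by omega) (by omega) hz
  · exact K.up_mem_of_between hS hij ha.le hb.le hz h
  · exact Or.inl (K.region_of_up hy' h)

/-- By `h`, the region lies between the wall from `e` and a translate of it by one period, on one
side or the other; the upper neighbours of its first vertex lie in layers before `i`. -/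
theorem disjoint_own_region {X : Set V} {i : ℕ} {a b e : ℤ}
    (h : (e ≤ a ∧ b ≤ e + K.per i) ∨ (b ≤ e ∧ e ≤ a + K.per i)) {v : V} (hv : v ∈ K.own X i e) :
    v ∉ K.region i a b := by
  rintro ⟨j, n, hij, rfl, ha, hb⟩
  obtain ⟨-, hv | ⟨j', hij', hv⟩⟩ := hv
  · obtain ⟨j', m, hj', h⟩ := K.exists_of_up hv
    obtain ⟨rfl, -⟩ := (K.pos_eq_iff _ _ _ _).1 h
    omega
  · obtain ⟨rfl, hdvd⟩ := (K.pos_eq_iff _ _ _ _).1 hv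
    have hp := K.per_pos j
    have hea := K.wall_add_per hij e
    have haa := K.wall_add_per hij a
    have mono := (K.wall_strictMono i j).monotone
    rcases h with ⟨h1, h2⟩ | ⟨h1, h2⟩
    · have h1 := mono h1
      have h2 := mono h2
      have := Int.le_of_dvd (by omega) hdvd
      omega
    · have h1 := mono h1
      have h2 := mono h2
      have := Int.le_of_dvd (by omega) ((dvd_neg.2 hdvd))
      omega

theorem disjoint_region {i : ℕ} {a b c : ℤ} (h : b ≤ a + K.per i) {v : V}
    (hv : v ∈ K.region i a c) : v ∉ K.region i c b := by
  rintro ⟨j, n, hij, rfl, ha, hb⟩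
  obtain ⟨j', m, hij', hv, ha', hb'⟩ := hv
  obtain ⟨rfl, hdvd⟩ := (K.pos_eq_iff _ _ _ _).1 hv
  have haa := K.wall_add_per hij a
  have h := (K.wall_strictMono i j).monotone h
  have := Int.le_of_dvd (by omega) hdvd
  omega

/-- Layer `i` has no position strictly between `a` and `a + 1`, so the walls can start one layer
later. This is what drives the induction over layers. -/
theorem region_succ (i : ℕ) (a : ℤ) :
    K.region i a (a + 1) = K.region (i + 1) (K.next i a) (K.next i (a + 1)) := by
  ext v
  constructor
  · rintro ⟨j, n, hij, rfl, ha, hb⟩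
    rcases hij.eq_or_lt with rfl | hij
    · rw [K.wall_of_le le_rfl] at ha hb
      omega
    · refine ⟨j, n, hij, rfl, ?_, ?_⟩ <;> rwa [K.wall_next hij]
  · rintro ⟨j, n, hij, rfl, ha, hb⟩
    rw [K.wall_next hij] at ha hb
    exact ⟨j, n, by omega, rfl, ha, hb⟩

theorem encard_union_le_add {α : Type*} {s t : Set α} {m n : ℕ} (hs : s.encard ≤ m)
    (ht : t.encard ≤ n) : (s ∪ t).encard ≤ ((m + n : ℕ) : ℕ∞) := by
  refine (Set.encard_union_le s t).trans ?_
  push_cast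
  exact add_le_add hs ht

/-- The two separators at the ends of a gap between consecutive positions separate the part of `X`
in between. -/
theorem hasDecomposition_gap {X : Set V} {M : ℕ}
    (hown : ∀ i a, (K.own X i a).encard ≤ M) {i : ℕ} {a : ℤ}
    (ih : HasDecomposition G ((5 * M : ℕ) : ℕ∞)
      (((K.own X i a ∪ K.own X i (a + 1)) ∪ (K.own X (i + 1) (K.next i a) ∪
        K.own X (i + 1) (K.next i (a + 1)))) ∪
          (K.region (i + 1) (K.next i a) (K.next i (a + 1)) ∩ X))
      ((K.own X i a ∪ K.own X i (a + 1)) ∪ (K.own X (i + 1) (K.next i a) ∪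
        K.own X (i + 1) (K.next i (a + 1)))))
    {S₀ : Set V} (hcard : S₀.encard ≤ ((2 * M : ℕ) : ℕ∞)) (hSX : S₀ ⊆ X)
    (hdisj : ∀ v ∈ S₀, v ∉ K.region i a (a + 1))
    (hS' : ∀ c, K.next i a ≤ c → c ≤ K.next i (a + 1) → ∀ z ∈ X, K.Up z (K.pos (i + 1) c) →
      z ∈ K.own X i a ∪ K.own X i (a + 1)) :
    HasDecomposition G ((5 * M : ℕ) : ℕ∞)
      ((S₀ ∪ (K.own X i a ∪ K.own X i (a + 1))) ∪ (K.region i a (a + 1) ∩ X))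
      (S₀ ∪ (K.own X i a ∪ K.own X i (a + 1))) := by
  have hper := K.per_pos i
  set O := K.own X i a ∪ K.own X i (a + 1)
  have hOreg : ∀ v ∈ O, v ∉ K.region i a (a + 1) := by
    rintro v (hv | hv)
    · exact K.disjoint_own_region (by omega) hv
    · exact K.disjoint_own_region (by omega) hv
  have hOX : O ⊆ X := Set.union_subset (fun v hv => hv.1) fun v hv => hv.1
  have hsub : K.own X (i + 1) (K.next i a) ∪ K.own X (i + 1) (K.next i (a + 1)) ⊆ O :=
    Set.union_subset_union (K.own_next_subset X i a) (K.own_next_subset X i (a + 1))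
  rw [Set.union_eq_self_of_subset_right hsub, ← K.region_succ] at ih
  have hB : (S₀ ∪ O).encard ≤ ((5 * M : ℕ) : ℕ∞) := by
    refine (encard_union_le_add hcard (encard_union_le_add (hown _ _) (hown _ _))).trans ?_
    exact_mod_cast (by omega)
  -- Inside a gap `S₀` is no longer needed: `O` alone separates. The root bag keeps `S₀` only for
  -- the decomposition outside.
  have := (HasDecomposition.single (G := G) hB).glue
    (C := K.region i a (a + 1) ∩ X) (S' := O) ih Set.subset_union_right ?_ ?_
  · exact this
  · rw [Set.disjoint_left]
    rintro v (hv | hv) hv'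
    · exact hdisj v hv hv'.1
    · exact hOreg v hv hv'.1
  · rintro u ⟨hu, -⟩ v hv huv
    have hvX : v ∈ X := hv.elim (fun h => hSX h) fun h => hOX h
    have hu' := hu
    rw [K.region_succ] at hu'
    rcases K.mem_of_adj_region hS' hu' hvX huv with h | h | h
    · rw [← K.region_succ] at h
      rcases hv with hv | hv
      · exact absurd h (hdisj v hv)
      · exact hv
    · exact h
    · exact hsub h

/-- The root bag is `S₀` with three walls, at most `2M + 3M` elements; this is the source of the
constant 5. The two halves are glued to it one after the other. -/
theorem hasDecomposition_split {X : Set V} {M : ℕ}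
    (hown : ∀ i a, (K.own X i a).encard ≤ M) {i : ℕ} {a b c : ℤ} (hac : a < c) (hcb : c < b)
    (hper : b ≤ a + K.per i)
    {S₀ : Set V} (hcard : S₀.encard ≤ ((2 * M : ℕ) : ℕ∞)) (hSX : S₀ ⊆ X)
    (hdisj : ∀ v ∈ S₀, v ∉ K.region i a b)
    (hS : ∀ c, a ≤ c → c ≤ b → ∀ z ∈ X, K.Up z (K.pos i c) → z ∈ S₀)
    (hl : HasDecomposition G ((5 * M : ℕ) : ℕ∞)
      ((S₀ ∪ (K.own X i a ∪ K.own X i c)) ∪ (K.region i a c ∩ X))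
      (S₀ ∪ (K.own X i a ∪ K.own X i c)))
    (hr : HasDecomposition G ((5 * M : ℕ) : ℕ∞)
      ((S₀ ∪ (K.own X i c ∪ K.own X i b)) ∪ (K.region i c b ∩ X))
      (S₀ ∪ (K.own X i c ∪ K.own X i b))) :
    HasDecomposition G ((5 * M : ℕ) : ℕ∞)
      ((S₀ ∪ (K.own X i a ∪ K.own X i b)) ∪ (K.region i a b ∩ X))
      (S₀ ∪ (K.own X i a ∪ K.own X i b)) := by
  have hregl : K.region i a c ⊆ K.region i a b := by
    rintro v ⟨j, n, hij, rfl, h1, h2⟩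
    exact ⟨j, n, hij, rfl, h1, h2.trans (K.wall_strictMono i j hcb)⟩
  have hregr : K.region i c b ⊆ K.region i a b := by
    rintro v ⟨j, n, hij, rfl, h1, h2⟩
    exact ⟨j, n, hij, rfl, (K.wall_strictMono i j hac).trans h1, h2⟩
  set B := S₀ ∪ (K.own X i a ∪ (K.own X i c ∪ K.own X i b))
  have hBcard : B.encard ≤ ((5 * M : ℕ) : ℕ∞) := by
    refine (encard_union_le_add hcard (encard_union_le_add (hown _ _)
      (encard_union_le_add (hown _ _) (hown _ _)))).trans ?_
    exact_mod_cast (by omega)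
  have hBX : B ⊆ X := by
    rintro v (h | h | h | h)
    · exact hSX h
    all_goals exact h.1
  have hBl : ∀ v ∈ B, v ∉ K.region i a c := by
    rintro v (h | h | h | h)
    · exact fun h' => hdisj v h (hregl h')
    all_goals exact K.disjoint_own_region (by omega) h
  have hBr : ∀ v ∈ B, v ∉ K.region i c b := by
    rintro v (h | h | h | h)
    · exact fun h' => hdisj v h (hregr h')
    all_goals exact K.disjoint_own_region (by omega) h
  have h1 := (HasDecomposition.single (G := G) hBcard).glue
    (C := K.region i a c ∩ X) hl
    (by
      rintro v (h | h | h)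
      · exact Or.inl h
      · exact Or.inr (Or.inl h)
      · exact Or.inr (Or.inr (Or.inl h)))
    (Set.disjoint_left.2 fun v hv hv' => hBl v hv hv'.1)
    (by
      rintro u ⟨hu, -⟩ v hv huv
      rcases K.mem_of_adj_region (fun e h1 h2 => hS e h1 (h2.trans hcb.le)) hu (hBX hv) huv
        with h | h
      · exact absurd h (hBl v hv)
      · exact h)
  have h2 := h1.glue (C := K.region i c b ∩ X) hr
    (by
      rintro v (h | h | h)
      · exact Or.inl h
      · exact Or.inr (Or.inr (Or.inl h))
      · exact Or.inr (Or.inr (Or.inr h)))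
    (by
      rw [Set.disjoint_left]
      rintro v (hv | hv) hv'
      · exact hBr v hv hv'.1
      · exact K.disjoint_region hper hv.1 hv'.1)
    (by
      rintro u ⟨hu, -⟩ v hv huv
      have hvX : v ∈ X := hv.elim (fun h => hBX h) fun h => h.2
      rcases K.mem_of_adj_region (fun e h1 h2 => hS e (hac.le.trans h1) h2) hu hvX huv
        with h | h
      · rcases hv with hv | hv
        · exact absurd h (hBr v hv)
        · exact absurd h (K.disjoint_region hper hv.1)
      · exact h)
  refine h2.mono ?_ ?_ Set.subset_union_left
  · rintro v ((h | h | h) | ⟨h, hX⟩)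
    · exact Or.inl (Or.inl (Or.inl h))
    · exact Or.inl (Or.inl (Or.inr (Or.inl h)))
    · exact Or.inl (Or.inl (Or.inr (Or.inr (Or.inr h))))
    · obtain ⟨j, n, hij, rfl, h1, h2⟩ := h
      rcases lt_trichotomy n (K.wall i j c) with h | rfl | h
      · exact Or.inl (Or.inr ⟨⟨j, n, hij, rfl, h1, h⟩, hX⟩)
      · exact Or.inl (Or.inl (Or.inr (Or.inr (Or.inl ⟨hX, Or.inr ⟨j, hij, rfl⟩⟩))))
      · exact Or.inr ⟨⟨j, n, hij, rfl, h, h2⟩, hX⟩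
  · rintro v (h | h | h)
    · exact Or.inl h
    · exact Or.inr (Or.inl h)
    · exact Or.inr (Or.inr (Or.inr h))

/-- Outer induction on the number `d` of layers left, inner induction on the number of gaps between
`a` and `b`. The set `S₀` holds all upper neighbours in `X` of the positions from `a` to `b`. In a
single gap, passing to the next layer replaces it by the own sets of the two ends, so its size stays
at most `2M`. -/
theorem hasDecomposition_region {X : Set V} {M top : ℕ}
    (hown : ∀ i a, (K.own X i a).encard ≤ M) (htop : ∀ j n, K.pos j n ∈ X → j < top) (d : ℕ) :
    ∀ (i : ℕ) (a b : ℤ) (S₀ : Set V), top ≤ i + d → a < b → b ≤ a + K.per i →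
      S₀.encard ≤ ((2 * M : ℕ) : ℕ∞) → S₀ ⊆ X → (∀ v ∈ S₀, v ∉ K.region i a b) →
      (∀ c, a ≤ c → c ≤ b → ∀ z ∈ X, K.Up z (K.pos i c) → z ∈ S₀) →
      HasDecomposition G ((5 * M : ℕ) : ℕ∞)
        ((S₀ ∪ (K.own X i a ∪ K.own X i b)) ∪ (K.region i a b ∩ X))
        (S₀ ∪ (K.own X i a ∪ K.own X i b)) := by
  induction d with
  | zero =>
    intro i a b S₀ hi hab hper hcard hSX hdisj hS
    have hempty : K.region i a b ∩ X = ∅ := by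
      rw [Set.eq_empty_iff_forall_notMem]
      rintro v ⟨⟨j, n, hij, rfl, -, -⟩, hX⟩
      have := htop j n hX
      omega
    rw [hempty, Set.union_empty]
    apply HasDecomposition.single
    refine (encard_union_le_add hcard (encard_union_le_add (hown _ _) (hown _ _))).trans ?_
    exact_mod_cast (by omega)
  | succ d ih =>
    have gap : ∀ (i : ℕ) (a : ℤ) (S₀ : Set V), top ≤ i + (d + 1) →
        S₀.encard ≤ ((2 * M : ℕ) : ℕ∞) → S₀ ⊆ X → (∀ v ∈ S₀, v ∉ K.region i a (a + 1)) →
        HasDecomposition G ((5 * M : ℕ) : ℕ∞)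
          ((S₀ ∪ (K.own X i a ∪ K.own X i (a + 1))) ∪ (K.region i a (a + 1) ∩ X))
          (S₀ ∪ (K.own X i a ∪ K.own X i (a + 1))) := by
      intro i a S₀ hi hcard hSX hdisj
      have hper := K.per_pos i
      have hS' : ∀ c, K.next i a ≤ c → c ≤ K.next i (a + 1) → ∀ z ∈ X,
          K.Up z (K.pos (i + 1) c) → z ∈ K.own X i a ∪ K.own X i (a + 1) := by
        intro c h1 h2 z hz hup
        have h1 := K.par_mono i h1
        have h2 := K.par_mono i h2
        rw [K.par_next] at h1 h2
        have hmem : z ∈ K.own X i (K.par i c) := by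
          refine ⟨hz, ?_⟩
          rcases K.up_succ _ _ _ hup with h | h
          · exact Or.inr ⟨i, le_rfl, by rwa [K.wall_of_le le_rfl]⟩
          · exact Or.inl h
        rcases (by omega : K.par i c = a ∨ K.par i c = a + 1) with h | h <;> rw [h] at hmem
        · exact Or.inl hmem
        · exact Or.inr hmem
      refine K.hasDecomposition_gap hown (ih (i + 1) _ _ _ (by omega)
        (K.next_strictMono i (by omega)) ?_ ?_ ?_ ?_ hS') hcard hSX hdisj hS'
      · rw [← K.next_add_per]
        exact (K.next_strictMono i).monotone (by omega)
      · refine (encard_union_le_add (hown _ _) (hown _ _)).trans ?_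
        exact_mod_cast (by omega)
      · exact Set.union_subset (fun v hv => hv.1) fun v hv => hv.1
      · rw [← K.region_succ]
        rintro v (hv | hv)
        · exact K.disjoint_own_region (by omega) hv
        · exact K.disjoint_own_region (by omega) hv
    suffices H : ∀ (k : ℕ) (i : ℕ) (a b : ℤ) (S₀ : Set V), b = a + 1 + k → top ≤ i + (d + 1) →
        b ≤ a + K.per i →
        S₀.encard ≤ ((2 * M : ℕ) : ℕ∞) → S₀ ⊆ X → (∀ v ∈ S₀, v ∉ K.region i a b) →
        (∀ c, a ≤ c → c ≤ b → ∀ z ∈ X, K.Up z (K.pos i c) → z ∈ S₀) →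
        HasDecomposition G ((5 * M : ℕ) : ℕ∞)
          ((S₀ ∪ (K.own X i a ∪ K.own X i b)) ∪ (K.region i a b ∩ X))
          (S₀ ∪ (K.own X i a ∪ K.own X i b)) by
      intro i a b S₀ hi hab
      exact H (b - a - 1).toNat i a b S₀ (by omega) hi
    intro k
    induction k with
    | zero =>
      intro i a b S₀ hb hi _ hcard hSX hdisj _
      obtain rfl : b = a + 1 := by simpa using hb
      exact gap i a S₀ hi hcard hSX hdisj
    | succ k ihk =>
      intro i a b S₀ hb hi hper hcard hSX hdisj hS
      push_cast at hb
      have hac : a < a + 1 := by omega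
      have hcb : a + 1 < b := by omega
      refine K.hasDecomposition_split hown hac hcb hper hcard hSX hdisj hS ?_ ?_
      · refine gap i a S₀ hi hcard hSX ?_
        rintro v hv ⟨j, n, hij, rfl, h1, h2⟩
        exact hdisj _ hv ⟨j, n, hij, rfl, h1, h2.trans (K.wall_strictMono i j hcb)⟩
      · refine ihk i (a + 1) b S₀ (by omega) hi (by omega) hcard hSX ?_
          (fun c h1 h2 => hS c (by omega) h2)
        rintro v hv ⟨j, n, hij, rfl, h1, h2⟩
        exact hdisj _ hv ⟨j, n, hij, rfl, (K.wall_strictMono i j hac).trans h1, h2⟩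

/-- The walls from `0` and `per 0` are the same wall of the graph, one period apart: this wall and
the region between its two lifts cover everything. In the first layer `S₀ = ∅` works. -/
theorem treewidth_le_of_own {X : Set V} {M top : ℕ}
    (hown : ∀ i a, (K.own X i a).encard ≤ M) (htop : ∀ j n, K.pos j n ∈ X → j < top) :
    treewidth (G.induce X) ≤ ((5 * M : ℕ) : ℕ∞) - 1 := by
  have h := K.hasDecomposition_region hown htop top 0 0 (K.per 0) ∅ (by omega) (K.per_pos 0)
    (by omega) (by simp) (by simp) (by simp) (fun c _ _ z _ h => absurd h (K.not_up_zero z c))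
  refine (h.mono (A' := X) (S' := ∅) ?_ (by simp) (by simp)).treewidth_le
  intro v hv
  obtain ⟨j, n, rfl⟩ := K.exists_pos v
  set w := K.wall 0 j 0
  have hp := K.per_pos j
  have hw : K.wall 0 j (K.per 0) = w + K.per j := by
    have := K.wall_add_per (Nat.zero_le j) 0
    rwa [zero_add] at this
  have heq : K.pos j n = K.pos j (w + (n - w) % K.per j) := by
    rw [K.pos_eq_iff]
    refine ⟨rfl, (n - w) / K.per j, ?_⟩
    have := Int.mul_ediv_add_emod (n - w) (K.per j)
    omega
  have h1 := Int.emod_nonneg (n - w) hp.ne'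
  have h2 := Int.emod_lt_of_pos (n - w) hp
  rw [heq] at hv ⊢
  rcases K.mem_of_between (X := X) (i := 0) (a := 0) (b := K.per 0) (Nat.zero_le j)
    (n := w + (n - w) % K.per j) (by omega) (by omega) hv with h | h
  · exact Or.inr ⟨h, hv⟩
  · exact Or.inl (Or.inr h)

/-- If walls keep all their elements of `X` as upper neighbours from layer `N` on, then the walls
have few elements in `X`. -/
theorem encard_own_le {X : Set V} {N k top : ℕ}
    (hkeep : ∀ j n, N ≤ j → ∀ z ∈ X, z = K.pos j n ∨ K.Up z (K.pos j n) →
      K.Up z (K.pos (j + 1) (K.next j n)))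
    (hclique : ∀ v, {z | z ∈ X ∧ K.Up z v}.encard ≤ k) (htop : ∀ j n, K.pos j n ∈ X → j < top)
    (i : ℕ) (a : ℤ) : (K.own X i a).encard ≤ ((N + 2 * k : ℕ) : ℕ∞) := by
  -- From layer `N` on, each wall vertex in `X` is an upper neighbour of all later vertices of the
  -- wall.
  have key : ∀ T, max i N ≤ T → ∀ j, max i N ≤ j → j < T → K.pos j (K.wall i j a) ∈ X →
      K.Up (K.pos j (K.wall i j a)) (K.pos T (K.wall i T a)) := by
    intro T hT
    induction T, hT using Nat.le_induction with
    | base => intro j h1 h2; omega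
    | succ T hT ih =>
      intro j h1 h2 hX
      rw [K.wall_succ (by omega : i ≤ T)]
      refine hkeep T _ (by omega) _ hX ?_
      rcases (by omega : j = T ∨ j < T) with rfl | h
      · exact Or.inl rfl
      · exact Or.inr (ih j h1 h hX)
  -- No element of `X` is in layer `T` or beyond, so every wall element in `X` from layer `N` on is
  -- an upper neighbour of the vertex in layer `T`.
  set T := max (max i N) top
  have hsub : K.own X i a ⊆ {z | z ∈ X ∧ K.Up z (K.pos i a)} ∪
      ((fun j => K.pos j (K.wall i j a)) '' (Finset.range N : Set ℕ) ∪
        {z | z ∈ X ∧ K.Up z (K.pos T (K.wall i T a))}) := by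
    rintro v ⟨hv, h | ⟨j, hij, rfl⟩⟩
    · exact Or.inl ⟨hv, h⟩
    · right
      by_cases hj : j < N
      · exact Or.inl ⟨j, by simpa using hj, rfl⟩
      · have := htop _ _ hv
        exact Or.inr ⟨hv, key T (by omega) j (by omega) (by omega) hv⟩
  refine (Set.encard_le_encard hsub).trans
    ((encard_union_le_add (hclique _) (encard_union_le_add (m := N) ?_ (hclique _))).trans ?_)
  · refine (Set.encard_image_le _ _).trans ?_
    rw [Set.encard_coe_eq_coe_finsetCard, Finset.card_range]
  · exact_mod_cast (by omega)

end LayerCover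

/-! ### Lifting maps between cycles to the integers -/

section CyclicLift

/-- The residue of an integer modulo `s`, as an element of `Fin s`. -/
def finRed (s : ℕ) (hs : 0 < s) (n : ℤ) : Fin s :=
  ⟨(n % s).toNat, by
    have := Int.emod_lt_of_pos n (by exact_mod_cast hs : (0 : ℤ) < s)
    have := Int.emod_nonneg n (by exact_mod_cast hs.ne' : (s : ℤ) ≠ 0)
    omega⟩

theorem coe_finRed (s : ℕ) (hs : 0 < s) (n : ℤ) : ((finRed s hs n : ℕ) : ℤ) = n % s :=
  Int.toNat_of_nonneg (Int.emod_nonneg n (by exact_mod_cast hs.ne'))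

theorem finRed_eq_iff {s : ℕ} {hs : 0 < s} {n m : ℤ} :
    finRed s hs n = finRed s hs m ↔ (s : ℤ) ∣ n - m := by
  rw [← Int.emod_eq_emod_iff_emod_sub_eq_zero.trans Int.dvd_iff_emod_eq_zero.symm,
    ← coe_finRed s hs, ← coe_finRed s hs, Fin.ext_iff, Nat.cast_inj]

theorem finRed_coe {s : ℕ} (hs : 0 < s) (p : Fin s) : finRed s hs ((p : ℕ) : ℤ) = p := by
  rw [Fin.ext_iff, ← Nat.cast_inj (R := ℤ), coe_finRed]
  exact Int.emod_eq_of_lt (by positivity) (by exact_mod_cast p.2)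

/-- The lift to the integers of a map between cyclically ordered sets. -/
def cyclicLift {s t : ℕ} (hs : 0 < s) (φ : Fin s → Fin t) (n : ℤ) : ℤ :=
  t * (n / s) + (φ (finRed s hs n) : ℕ)

theorem cyclicLift_ediv {s t : ℕ} (hs : 0 < s) (φ : Fin s → Fin t) (n : ℤ) :
    cyclicLift hs φ n / t = n / s := by
  have h : ((φ (finRed s hs n) : ℕ) : ℤ) < t := by exact_mod_cast (φ (finRed s hs n)).2
  have h0 : (0 : ℤ) ≤ ((φ (finRed s hs n) : ℕ) : ℤ) := by positivity
  rw [cyclicLift, add_comm, Int.add_mul_ediv_left _ _ (by omega), Int.ediv_eq_zero_of_lt h0 h,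
    zero_add]

theorem finRed_cyclicLift {s t : ℕ} (hs : 0 < s) (ht : 0 < t) (φ : Fin s → Fin t) (n : ℤ) :
    finRed t ht (cyclicLift hs φ n) = φ (finRed s hs n) := by
  rw [← finRed_coe ht (φ (finRed s hs n)), finRed_eq_iff]
  exact ⟨n / s, by rw [cyclicLift]; ring⟩

theorem cyclicLift_add {s t : ℕ} (hs : 0 < s) (φ : Fin s → Fin t) (n : ℤ) :
    cyclicLift hs φ (n + s) = cyclicLift hs φ n + t := by
  have h : finRed s hs (n + s) = finRed s hs n := finRed_eq_iff.2 ⟨1, by ring⟩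
  rw [cyclicLift, cyclicLift, h, Int.add_ediv_of_dvd_right (dvd_refl _),
    Int.ediv_self (by exact_mod_cast hs.ne')]
  ring

theorem cyclicLift_comp {s t : ℕ} (hs : 0 < s) (ht : 0 < t) {φ : Fin s → Fin t}
    {ψ : Fin t → Fin s} (h : ∀ p, ψ (φ p) = p) (n : ℤ) :
    cyclicLift ht ψ (cyclicLift hs φ n) = n := by
  rw [cyclicLift, cyclicLift_ediv, finRed_cyclicLift hs ht, h, coe_finRed]
  exact Int.mul_ediv_add_emod n s

theorem cyclicLift_monotone {s t : ℕ} (hs : 0 < s) {φ : Fin s → Fin t} (h : Monotone φ) :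
    Monotone (cyclicLift hs φ) := by
  intro n m hnm
  have hs' : (0 : ℤ) < s := by exact_mod_cast hs
  have hq : n / s ≤ m / s := Int.ediv_le_ediv hs' hnm
  have hn := Int.mul_ediv_add_emod n s
  have hm := Int.mul_ediv_add_emod m s
  have h1 : ((φ (finRed s hs n) : ℕ) : ℤ) < t := by exact_mod_cast (φ (finRed s hs n)).2
  rcases hq.eq_or_lt with hq | hq
  · have hle : finRed s hs n ≤ finRed s hs m := by
      rw [Fin.le_def, ← Nat.cast_le (α := ℤ), coe_finRed, coe_finRed]
      rw [hq] at hn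
      omega
    have : ((φ (finRed s hs n) : ℕ) : ℤ) ≤ (φ (finRed s hs m) : ℕ) := by exact_mod_cast h hle
    rw [cyclicLift, cyclicLift, hq]
    omega
  -- In different periods the offsets, which are below `t`, cannot make up for the difference of the
  -- quotients.
  · have h2 : (t : ℤ) * (n / s + 1) ≤ t * (m / s) :=
      mul_le_mul_of_nonneg_left (by omega) (by positivity)
    rw [cyclicLift, cyclicLift]
    have : (0 : ℤ) ≤ (φ (finRed s hs m) : ℕ) := by positivity
    linarith

/-- An element of an earlier block precedes the partial sum at which a later block starts. Used for
monotonicity of the parent map. -/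
theorem finSigmaFinEquiv_symm_fst_monotone {m : ℕ} {n : Fin m → ℕ} :
    Monotone fun x : Fin (∑ i, n i) => (finSigmaFinEquiv.symm x).1 := by
  intro x y hxy
  by_contra h
  have h : (finSigmaFinEquiv.symm y).1 < (finSigmaFinEquiv.symm x).1 := not_le.1 h
  have hx := finSigmaFinEquiv_apply (finSigmaFinEquiv.symm x)
  have hy := finSigmaFinEquiv_apply (finSigmaFinEquiv.symm y)
  rw [Equiv.apply_symm_apply] at hx hy
  generalize finSigmaFinEquiv.symm x = a at *
  generalize finSigmaFinEquiv.symm y = b at *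
  let g : ℕ → ℕ := fun i => if h : i < m then n ⟨i, h⟩ else 0
  have hg : ∀ c : Fin m, ∑ i : Fin c, n (Fin.castLE c.2.le i) = ∑ i ∈ Finset.range c, g i := by
    intro c
    rw [← Fin.sum_univ_eq_sum_range]
    refine Finset.sum_congr rfl fun i _ => ?_
    have : (i : ℕ) < m := i.2.trans c.2
    simp only [g, this, dif_pos]
    rfl
  rw [hg] at hx hy
  have hle : ∑ i ∈ Finset.range ((b.1 : ℕ) + 1), g i ≤ ∑ i ∈ Finset.range a.1, g i :=
    Finset.sum_le_sum_of_subset (Finset.range_subset_range.2 h)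
  rw [Finset.sum_range_succ] at hle
  have hgb : g b.1 = n b.1 := by simp [g]
  have hb := b.2.2
  rw [Fin.le_def] at hxy
  omega

end CyclicLift

/-! ### From one layer to the next -/

namespace LayeredWheel

theorem dvd_pathLength (m ℓ : ℕ) (N : List (ℕ × ℕ)) : ℓ - 2 ∣ pathLength m ℓ N := by
  unfold pathLength
  split_ifs
  · exact dvd_rfl
  · exact dvd_mul_left _ _

theorem le_pathLength {m ℓ : ℕ} (hm : 1 ≤ m) (N : List (ℕ × ℕ)) : ℓ - 2 ≤ pathLength m ℓ N := by
  unfold pathLength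
  split_ifs
  · exact le_rfl
  · exact Nat.le_mul_of_pos_left _ hm

/-- The position of the vertex `v` such that the given vertex of the next layer is on the path
`L(v)`. -/
def parent {m ℓ i : ℕ} {L : Layer} (x : Fin (nextLayer m ℓ i L).size) : Fin L.size :=
  (finSigmaFinEquiv.symm x).1

theorem parent_monotone {m ℓ i : ℕ} {L : Layer} :
    Monotone (parent : Fin (nextLayer m ℓ i L).size → Fin L.size) :=
  finSigmaFinEquiv_symm_fst_monotone

theorem nextLayer_spec {m ℓ i : ℕ} {L : Layer} (x : Fin (nextLayer m ℓ i L).size) :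
    ∃ j < pathLength m ℓ (L.up (parent x)), ℓ - 2 ∣ (x : ℕ) - j ∧ j ≤ x ∧
      (nextLayer m ℓ i L).up x = pathUp m ℓ (i, (parent x : ℕ)) (L.up (parent x)) j := by
  have hx : ((finSigmaFinEquiv (finSigmaFinEquiv.symm x) :
      Fin (∑ p : Fin L.size, pathLength m ℓ (L.up p))) : ℕ) = x :=
    congrArg _ (Equiv.apply_symm_apply finSigmaFinEquiv x)
  rw [finSigmaFinEquiv_apply] at hx
  refine ⟨_, (finSigmaFinEquiv.symm x).2.2, ?_, ?_, rfl⟩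
  · rw [← hx, Nat.add_sub_cancel]
    exact Finset.dvd_sum fun _ _ => dvd_pathLength _ _ _
  · exact hx ▸ Nat.le_add_left _ _

theorem mem_nextLayer_up {m ℓ i : ℕ} {L : Layer} {x : Fin (nextLayer m ℓ i L).size} {q : ℕ × ℕ}
    (h : q ∈ (nextLayer m ℓ i L).up x) : q = (i, (parent x : ℕ)) ∨ q ∈ L.up (parent x) := by
  obtain ⟨j, -, -, -, hup⟩ := nextLayer_spec x
  rw [hup] at h
  unfold pathUp at h
  split_ifs at h
  · rw [List.mem_append, List.mem_singleton] at h
    exact h.symm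
  · rw [List.mem_append, List.mem_singleton] at h
    exact h.symm.imp_right fun h => List.mem_of_mem_eraseIdx h
  · simp at h

/-- The index `a` of the dropped neighbour matters only for a full list; `a = 0` is also allowed so
that empty lists are covered. -/
theorem exists_child {m ℓ i : ℕ} {L : Layer} (hm : 1 ≤ m) (hℓ : 4 ≤ ℓ)
    (p : Fin L.size) (hlen : (L.up p).length ≤ m) (a : ℕ) (ha : a = 0 ∨ a < (L.up p).length) :
    ∃ x : Fin (nextLayer m ℓ i L).size, parent x = p ∧ (nextLayer m ℓ i L).up x =
      (if (L.up p).length < m then L.up p else (L.up p).eraseIdx a) ++ [(i, (p : ℕ))] := by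
  have hidx : (if (L.up p).length < m then 0 else a * (ℓ - 2)) < pathLength m ℓ (L.up p) := by
    unfold pathLength
    split_ifs
    · omega
    · exact Nat.mul_lt_mul_of_pos_right (by omega) (by omega)
  refine ⟨finSigmaFinEquiv ⟨p, ⟨_, hidx⟩⟩, ?_, ?_⟩
  · exact congrArg Sigma.fst (Equiv.symm_apply_apply finSigmaFinEquiv _)
  · dsimp only [nextLayer]
    rw [Equiv.symm_apply_apply]
    dsimp only
    unfold pathUp
    split_ifs with h h'
    · rfl
    · simp at h'
    · rw [Nat.mul_div_cancel _ (by omega)]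
    · simp at *

/-- The properties of the layer number `i` of a wheel in which every vertex has at most `b` upper
neighbours. -/
structure Layer.IsRegular (ℓ i b : ℕ) (L : Layer) : Prop where
  le_size : ℓ ≤ L.size
  length_le : ∀ p, (L.up p).length ≤ b
  exists_length : ∃ p, (L.up p).length = b
  sorted : ∀ p, (L.up p).Pairwise fun q q' => q.1 < q'.1
  lt : ∀ p, ∀ q ∈ L.up p, q.1 < i
  dvd_pos : ∀ p, L.up p ≠ [] → ℓ - 2 ∣ (p : ℕ)
  dvd_size : (∃ p, L.up p ≠ []) → ℓ - 2 ∣ L.size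

theorem Layer.IsRegular.next {ℓ i b m : ℕ} {L : Layer} (h : L.IsRegular ℓ i b) (hℓ : 4 ≤ ℓ)
    (hm : 1 ≤ m) (hbm : b ≤ m) (hmb : m ≤ b + 1) :
    (nextLayer m ℓ i L).IsRegular ℓ (i + 1) m where
  le_size := by
    have : L.size * (ℓ - 2) ≤ (nextLayer m ℓ i L).size := by
      calc L.size * (ℓ - 2) = ∑ _p : Fin L.size, (ℓ - 2) := by simp
        _ ≤ _ := Finset.sum_le_sum fun p _ => le_pathLength hm _
    have h2 : L.size * 2 ≤ L.size * (ℓ - 2) := Nat.mul_le_mul_left _ (by omega)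
    have := h.le_size
    omega
  length_le x := by
    obtain ⟨j, hj, -, -, hup⟩ := nextLayer_spec x
    have h3 := h.length_le (parent x)
    rw [hup]
    unfold pathUp
    split_ifs with h1 h2
    · simp only [List.length_append, List.length_singleton]; omega
    · have hlt : j / (ℓ - 2) < (L.up (parent x)).length := by
        unfold pathLength at hj
        rw [if_neg h2] at hj
        rw [Nat.div_lt_iff_lt_mul (by omega)]
        exact hj.trans_le (Nat.mul_le_mul_right _ (by omega))
      simp only [List.length_append, List.length_singleton, List.length_eraseIdx_of_lt hlt]
      omega
    · simp
  exists_length := by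
    obtain ⟨p, hp⟩ := h.exists_length
    obtain ⟨x, -, hx⟩ := exists_child (i := i) hm hℓ p (by omega) 0 (Or.inl rfl)
    refine ⟨x, ?_⟩
    rw [hx]
    split_ifs with h1
    · simp only [List.length_append, List.length_singleton]; omega
    · simp only [List.length_append, List.length_singleton]
      rw [List.length_eraseIdx_of_lt (by omega)]
      omega
  sorted x := by
    have key : ∀ N : List (ℕ × ℕ), N.Sublist (L.up (parent x)) →
        (N ++ [(i, (parent x : ℕ))]).Pairwise fun q q' => q.1 < q'.1 := by
      intro N hN
      rw [List.pairwise_append]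
      refine ⟨(h.sorted _).sublist hN, List.pairwise_singleton _ _, ?_⟩
      intro q hq q' hq'
      rw [List.mem_singleton] at hq'
      rw [hq']
      exact h.lt _ q (hN.subset hq)
    obtain ⟨j, hj, -, -, hup⟩ := nextLayer_spec x
    rw [hup]
    unfold pathUp
    split_ifs
    · exact key _ (List.Sublist.refl _)
    · exact key _ (List.eraseIdx_sublist _ _)
    · exact List.Pairwise.nil
  lt x q hq := by
    rcases mem_nextLayer_up hq with rfl | hq
    · exact Nat.lt_succ_self i
    · exact (h.lt _ q hq).trans (Nat.lt_succ_self i)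
  dvd_pos x hx := by
    obtain ⟨j, hj, hdvd, hle, hup⟩ := nextLayer_spec x
    rw [← Nat.sub_add_cancel hle]
    refine dvd_add hdvd ?_
    by_contra hc
    apply hx
    rw [hup]
    unfold pathUp
    rw [if_neg fun h => hc (Nat.dvd_of_mod_eq_zero h)]
  dvd_size _ := by
    change ℓ - 2 ∣ ∑ p, pathLength m ℓ (L.up p)
    exact Finset.dvd_sum fun _ _ => dvd_pathLength _ _ _

end LayeredWheel

/-! ### Slow functions -/

section Slow

theorem IsSlow.le_of_le {f : ℕ → ℕ} (hf : IsSlow f) {i j : ℕ} (hi : 1 ≤ i) (hij : i ≤ j) :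
    f i ≤ f j := by
  induction j, hij using Nat.le_induction with
  | base => exact le_rfl
  | succ j hij ih => exact ih.trans (hf.mono j (by omega))

theorem IsSlow.one_le {f : ℕ → ℕ} (hf : IsSlow f) {i : ℕ} (hi : 1 ≤ i) : 1 ≤ f i :=
  hf.one ▸ hf.le_of_le le_rfl hi

theorem IsSlow.two_le {f : ℕ → ℕ} (hf : IsSlow f) {i : ℕ} (hi : 2 ≤ i) : 2 ≤ f i :=
  hf.two ▸ hf.le_of_le (by omega) hi

theorem IsSlow.three_le {f : ℕ → ℕ} (hf : IsSlow f) {i : ℕ} (hi : 3 ≤ i) : 3 ≤ f i :=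
  hf.three ▸ hf.le_of_le (by omega) hi

theorem IsSlow.le_of_le_cumulative {f : ℕ → ℕ} (hf : IsSlow f) {k t : ℕ} (ht : 1 ≤ t)
    (h : (t : ℕ∞) ≤ cumulative f k) :
    f t ≤ k := by
  by_contra hc
  have hle : cumulative f k ≤ ((t - 1 : ℕ) : ℕ∞) := by
    refine sSup_le ?_
    rintro n ⟨i, hi, hik, rfl⟩
    have : ¬ t ≤ i := fun hti => hc ((hf.le_of_le ht hti).trans hik)
    exact_mod_cast (by omega : i ≤ t - 1)
  have := h.trans hle
  have : t ≤ t - 1 := by exact_mod_cast this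
  omega

end Slow

theorem le_cumulative {f : ℕ → ℕ} {i k : ℕ} (hi : 1 ≤ i) (h : f i ≤ k) :
    (i : ℕ∞) ≤ cumulative f k :=
  le_sSup ⟨i, hi, h, rfl⟩

/-! ### Upper neighbours in the wheel and its universal cover -/

namespace LayeredWheel

variable {f : ℕ → ℕ} {ℓ : ℕ}

theorem isRegular_layer (hf : IsSlow f) (hℓ : 4 ≤ ℓ) (i : ℕ) :
    (layer f ℓ (i + 1)).IsRegular ℓ (i + 1) (f (i + 1) - 1) := by
  induction i with
  | zero =>
    refine ⟨le_rfl, fun p => Nat.zero_le _, ⟨⟨0, by change 0 < ℓ; omega⟩, ?_⟩,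
      fun p => List.Pairwise.nil, fun p q hq => ?_, fun p hp => absurd rfl hp,
      fun ⟨p, hp⟩ => absurd rfl hp⟩
    · rw [hf.one]; rfl
    · exact absurd hq List.not_mem_nil
  | succ i ih =>
    have h1 := hf.mono (i + 1) (by omega)
    have h2 := hf.step (i + 1) (by omega)
    have h3 := hf.two_le (i := i + 1 + 1) (by omega)
    exact ih.next hℓ (by omega) (by omega) (by omega)

/-- `IsUp u v` means that `u` is an upper neighbour of `v`. -/
def IsUp (u v : Vertex f ℓ) : Prop := (u.1, (u.2 : ℕ)) ∈ (layer f ℓ v.1).up v.2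

theorem vertex_ext {u v : Vertex f ℓ} (h1 : u.1 = v.1) (h2 : (u.2 : ℕ) = v.2) : u = v := by
  obtain ⟨i, p⟩ := u
  obtain ⟨j, q⟩ := v
  dsimp only at h1
  subst h1
  exact congrArg _ (Fin.ext h2)

theorem code_injective :
    Function.Injective fun u : Vertex f ℓ => (u.1, (u.2 : ℕ)) := by
  intro u v h
  rw [Prod.mk.injEq] at h
  exact vertex_ext h.1 h.2

theorem exists_eq_succ (v : Vertex f ℓ) : ∃ i, ∃ p : Fin (layer f ℓ (i + 1)).size,
    v = ⟨i + 1, p⟩ := by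
  obtain ⟨i, p⟩ := v
  cases i with
  | zero => exact absurd p.2 (Nat.not_lt_zero _)
  | succ i => exact ⟨i, p, rfl⟩

/-- `parent`, for the layers of a wheel. -/
def par (i : ℕ) (x : Fin (layer f ℓ (i + 2)).size) : Fin (layer f ℓ (i + 1)).size :=
  parent x

theorem par_monotone (i : ℕ) : Monotone (par (f := f) (ℓ := ℓ) i) := parent_monotone

theorem mem_up_succ {i : ℕ} {x : Fin (layer f ℓ (i + 2)).size} {q : ℕ × ℕ}
    (h : q ∈ (layer f ℓ (i + 2)).up x) :
    q = (i + 1, (par i x : ℕ)) ∨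
      q ∈ (layer f ℓ (i + 1)).up (par i x) :=
  mem_nextLayer_up h

theorem isUp_succ {i : ℕ} {x : Fin (layer f ℓ (i + 2)).size} {u : Vertex f ℓ}
    (h : IsUp u ⟨i + 2, x⟩) : u = ⟨i + 1, par i x⟩ ∨ IsUp u ⟨i + 1, par i x⟩ := by
  rcases mem_up_succ h with h | h
  · rw [Prod.mk.injEq] at h
    exact Or.inl (vertex_ext h.1 h.2)
  · exact Or.inr h

theorem exists_isUp {v : Vertex f ℓ} {q : ℕ × ℕ} (h : q ∈ (layer f ℓ v.1).up v.2) :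
    ∃ u : Vertex f ℓ, q = (u.1, (u.2 : ℕ)) := by
  obtain ⟨i, p, rfl⟩ := exists_eq_succ v
  induction i with
  | zero => exact absurd h List.not_mem_nil
  | succ i ih =>
    rcases mem_up_succ h with h | h
    · exact ⟨⟨i + 1, par i p⟩, h⟩
    · exact ih _ h

/-- Pass from `v` to its parent until the parent is `u` or `w`; the other one is then an upper
neighbour of it. Hence upper neighbourhoods are cliques. -/
theorem IsUp.isUp_or {v u w : Vertex f ℓ} (hu : IsUp u v) (hw : IsUp w v) (huw : u ≠ w) :
    IsUp u w ∨ IsUp w u := by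
  obtain ⟨i, p, rfl⟩ := exists_eq_succ v
  induction i with
  | zero => exact absurd hu List.not_mem_nil
  | succ i ih =>
    rcases isUp_succ hu with rfl | hu <;> rcases isUp_succ hw with rfl | hw
    · exact absurd rfl huw
    · exact Or.inr hw
    · exact Or.inl hu
    · exact ih _ hu hw

theorem IsUp.lt (hf : IsSlow f) (hℓ : 4 ≤ ℓ) {u v : Vertex f ℓ} (h : IsUp u v) : u.1 < v.1 := by
  obtain ⟨i, p, rfl⟩ := exists_eq_succ v
  exact (isRegular_layer hf hℓ i).lt p _ h

theorem IsUp.adj (hf : IsSlow f) (hℓ : 4 ≤ ℓ) {u v : Vertex f ℓ} (h : IsUp u v) :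
    (layeredWheel f ℓ).Adj u v := by
  refine (SimpleGraph.fromRel_adj _ _ _).2 ⟨?_, Or.inl (Or.inr h)⟩
  rintro rfl
  exact lt_irrefl _ (h.lt hf hℓ)

theorem size_pos (hf : IsSlow f) (hℓ : 4 ≤ ℓ) (i : ℕ) : 0 < (layer f ℓ (i + 1)).size := by
  have := (isRegular_layer hf hℓ i).le_size
  omega

/-- The vertices of the wheel, with the positions in each layer read modulo its size. -/
def posVertex (hf : IsSlow f) (hℓ : 4 ≤ ℓ) (i : ℕ) (n : ℤ) : Vertex f ℓ :=
  ⟨i + 1, finRed _ (size_pos hf hℓ i) n⟩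

theorem posVertex_eq_iff (hf : IsSlow f) (hℓ : 4 ≤ ℓ) (i : ℕ) (n : ℤ) (j : ℕ) (m : ℤ) :
    posVertex hf hℓ i n = posVertex hf hℓ j m ↔
      i = j ∧ ((layer f ℓ (i + 1)).size : ℤ) ∣ n - m := by
  constructor
  · intro h
    have h1 : i + 1 = j + 1 := congrArg Sigma.fst h
    obtain rfl : i = j := by omega
    exact ⟨rfl, finRed_eq_iff.1 (eq_of_heq (Sigma.mk.inj h).2)⟩
  · rintro ⟨rfl, h⟩
    unfold posVertex
    rw [finRed_eq_iff.2 h]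

theorem adj_posVertex (hf : IsSlow f) (hℓ : 4 ≤ ℓ) (j : ℕ) (n : ℤ) (z : Vertex f ℓ)
    (h : (layeredWheel f ℓ).Adj (posVertex hf hℓ j n) z) :
    z = posVertex hf hℓ j (n + 1) ∨ z = posVertex hf hℓ j (n - 1) ∨
      IsUp z (posVertex hf hℓ j n) ∨ IsUp (posVertex hf hℓ j n) z := by
  have hs := size_pos hf hℓ j
  rcases ((SimpleGraph.fromRel_adj _ _ _).1 h).2 with (⟨h1, h2⟩ | h) | (⟨h1, h2⟩ | h)
  · left
    obtain ⟨i, q⟩ := z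
    dsimp only [posVertex] at h1 h2
    subst h1
    refine vertex_ext rfl ?_
    dsimp only [posVertex]
    rw [h2, ← Nat.cast_inj (R := ℤ), coe_finRed]
    push_cast
    rw [coe_finRed, Int.emod_add_emod]
  · exact Or.inr (Or.inr (Or.inr h))
  · right; left
    obtain ⟨i, q⟩ := z
    dsimp only [posVertex] at h1 h2
    subst h1
    refine vertex_ext rfl ?_
    dsimp only [posVertex]
    rw [← Fin.ext_iff, ← finRed_coe hs q, finRed_eq_iff]
    rw [← Nat.cast_inj (R := ℤ), coe_finRed] at h2
    push_cast at h2
    have := (Int.emod_emod_of_dvd n (dvd_refl _)).symm.trans (congrArg (· % _) h2)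
    rw [Int.emod_emod_of_dvd _ (dvd_refl _)] at this
    have := Int.ModEq.dvd this
    rwa [show ((q : ℕ) : ℤ) - (n - 1) = (q : ℕ) + 1 - n by ring]
  · exact Or.inr (Or.inr (Or.inl h))

/-- The universal cover of the layered wheel, for a given choice of a child of every vertex. -/
def cover (hf : IsSlow f) (hℓ : 4 ≤ ℓ)
    (next : ∀ i, Fin (layer f ℓ (i + 1)).size → Fin (layer f ℓ (i + 2)).size)
    (hnext : ∀ i p, par i (next i p) = p) : LayerCover (layeredWheel f ℓ) where
  pos := posVertex hf hℓ
  par i := cyclicLift (size_pos hf hℓ (i + 1)) (par i)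
  next i := cyclicLift (size_pos hf hℓ i) (next i)
  per i := (layer f ℓ (i + 1)).size
  Up := IsUp
  per_pos i := by exact_mod_cast size_pos hf hℓ i
  pos_eq_iff := posVertex_eq_iff hf hℓ
  exists_pos v := by
    obtain ⟨i, p, rfl⟩ := exists_eq_succ v
    exact ⟨i, (p : ℕ), by rw [posVertex, finRed_coe]⟩
  par_mono i := cyclicLift_monotone _ (par_monotone i)
  par_add_per i n := cyclicLift_add _ _ n
  next_add_per i n := cyclicLift_add _ _ n
  par_next i n := cyclicLift_comp _ _ (hnext i) n
  not_up_zero z n h := absurd h List.not_mem_nil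
  up_succ z i n h := by
    have hp : posVertex hf hℓ i (cyclicLift (size_pos hf hℓ (i + 1)) (par i) n) =
        ⟨i + 1, par i (finRed _ (size_pos hf hℓ (i + 1)) n)⟩ := by
      rw [posVertex, finRed_cyclicLift]
    rw [hp]
    exact isUp_succ h
  adj := adj_posVertex hf hℓ

end LayeredWheel

/-! ### Cliques of upper neighbours and the upper bound -/

theorem SimpleGraph.IsClique.card_le_cliqueNum_induce {V : Type*} {G : SimpleGraph V}
    {X s : Finset V} (hs : G.IsClique (s : Set V)) (hX : s ⊆ X) :
    s.card ≤ (G.induce (X : Set V)).cliqueNum := by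
  classical
  have h := SimpleGraph.IsClique.card_le_cliqueNum (G := G.induce (X : Set V))
    (t := s.subtype (· ∈ (X : Set V))) (tc := by
      intro u hu v hv huv
      exact hs (Finset.mem_subtype.1 hu) (Finset.mem_subtype.1 hv) fun h => huv (Subtype.ext h))
  rwa [Finset.card_subtype, Finset.filter_true_of_mem (p := (· ∈ (X : Set V)))
    fun x hx => hX hx] at h

theorem SimpleGraph.exists_isClique_card_eq_cliqueNum_induce {V : Type*} (G : SimpleGraph V)
    (X : Finset V) : ∃ s ⊆ X, G.IsClique (s : Set V) ∧
      s.card = (G.induce (X : Set V)).cliqueNum := by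
  classical
  obtain ⟨s, hs⟩ := SimpleGraph.exists_isNClique_cliqueNum (G := G.induce (X : Set V))
  refine ⟨s.map (Function.Embedding.subtype _), ?_, ?_, by rw [Finset.card_map, hs.card_eq]⟩
  · intro x hx
    obtain ⟨y, -, rfl⟩ := Finset.mem_map.1 hx
    exact y.2
  · intro u hu v hv huv
    obtain ⟨u, hu', rfl⟩ := Finset.mem_map.1 hu
    obtain ⟨v, hv', rfl⟩ := Finset.mem_map.1 hv
    exact hs.isClique hu' hv' fun h => huv (congrArg _ h)

namespace LayeredWheel

variable {f : ℕ → ℕ} {ℓ : ℕ}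

theorem exists_child_vertex (hf : IsSlow f) (hℓ : 4 ≤ ℓ) (i : ℕ)
    (p : Fin (layer f ℓ (i + 1)).size) (a : ℕ)
    (ha : a = 0 ∨ a < ((layer f ℓ (i + 1)).up p).length) :
    ∃ x, par i x = p ∧ (layer f ℓ (i + 2)).up x =
      (if ((layer f ℓ (i + 1)).up p).length < f (i + 2) - 1 then (layer f ℓ (i + 1)).up p
        else ((layer f ℓ (i + 1)).up p).eraseIdx a) ++ [(i + 1, (p : ℕ))] := by
  have h1 := (isRegular_layer hf hℓ i).length_le p
  have h2 : f (i + 1) ≤ f (i + 2) := hf.mono (i + 1) (by omega)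
  have h3 := hf.two_le (i := i + 2) (by omega)
  exact exists_child (by omega) hℓ p (by omega) a ha

theorem one_le_layer (v : Vertex f ℓ) : 1 ≤ v.1 := by
  obtain ⟨i, p, rfl⟩ := exists_eq_succ v
  exact Nat.le_add_left 1 i

theorem length_up_le (hf : IsSlow f) (hℓ : 4 ≤ ℓ) (v : Vertex f ℓ) :
    ((layer f ℓ v.1).up v.2).length ≤ f v.1 - 1 := by
  obtain ⟨i, p, rfl⟩ := exists_eq_succ v
  exact (isRegular_layer hf hℓ i).length_le p

theorem nodup_up (hf : IsSlow f) (hℓ : 4 ≤ ℓ) (v : Vertex f ℓ) :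
    ((layer f ℓ v.1).up v.2).Nodup := by
  obtain ⟨i, p, rfl⟩ := exists_eq_succ v
  refine ((isRegular_layer hf hℓ i).sorted p).imp ?_
  rintro q q' h rfl
  exact lt_irrefl _ h

theorem card_le_length_up {s : Finset (Vertex f ℓ)} {v : Vertex f ℓ} (h : ∀ u ∈ s, IsUp u v) :
    s.card ≤ ((layer f ℓ v.1).up v.2).length := by
  refine (Finset.card_le_card_of_injOn (t := ((layer f ℓ v.1).up v.2).toFinset)
    (fun u => (u.1, (u.2 : ℕ))) (fun u hu => ?_) code_injective.injOn).trans
    (List.toFinset_card_le _)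
  exact List.mem_toFinset.2 (h u hu)

theorem length_up_le_card (hf : IsSlow f) (hℓ : 4 ≤ ℓ) {s : Finset (Vertex f ℓ)} {v : Vertex f ℓ}
    (h : ∀ u, IsUp u v → u ∈ s) : ((layer f ℓ v.1).up v.2).length ≤ s.card := by
  rw [← List.toFinset_card_of_nodup (nodup_up hf hℓ v)]
  refine (Finset.card_le_card (t := s.image fun u => (u.1, (u.2 : ℕ))) fun q hq => ?_).trans
    Finset.card_image_le
  obtain ⟨u, rfl⟩ := exists_isUp (List.mem_toFinset.1 hq)
  exact Finset.mem_image_of_mem _ (h u (List.mem_toFinset.1 hq))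

theorem isClique_of_isUp (hf : IsSlow f) (hℓ : 4 ≤ ℓ) {s : Set (Vertex f ℓ)} {v : Vertex f ℓ}
    (h : ∀ u ∈ s, u = v ∨ IsUp u v) : (layeredWheel f ℓ).IsClique s := by
  intro u hu w hw huw
  rcases h u hu with rfl | hu <;> rcases h w hw with rfl | hw
  · exact absurd rfl huw
  · exact (hw.adj hf hℓ).symm
  · exact hu.adj hf hℓ
  · rcases hu.isUp_or hw huw with h | h
    · exact h.adj hf hℓ
    · exact (h.adj hf hℓ).symm

theorem card_isUp_le_cliqueNum (hf : IsSlow f) (hℓ : 4 ≤ ℓ) {X s : Finset (Vertex f ℓ)}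
    {v : Vertex f ℓ} (hX : s ⊆ X) (h : ∀ u ∈ s, IsUp u v) :
    s.card ≤ ((layeredWheel f ℓ).induce (X : Set (Vertex f ℓ))).cliqueNum :=
  SimpleGraph.IsClique.card_le_cliqueNum_induce
    (isClique_of_isUp hf hℓ fun u hu => Or.inr (h u hu)) hX

/-- In a layer whose vertices have more upper neighbours than the clique number of `X`, every vertex
has a child that keeps all the upper neighbours in `X`. -/
theorem exists_next (hf : IsSlow f) (hℓ : 4 ≤ ℓ) (X : Finset (Vertex f ℓ)) (i : ℕ)
    (p : Fin (layer f ℓ (i + 1)).size) :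
    ∃ x, par i x = p ∧
      (((layeredWheel f ℓ).induce (X : Set (Vertex f ℓ))).cliqueNum + 2 ≤ f (i + 2) →
        ∀ z ∈ X, z = ⟨i + 1, p⟩ ∨ IsUp z ⟨i + 1, p⟩ → IsUp z ⟨i + 2, x⟩) := by
  classical
  by_cases hk : ((layeredWheel f ℓ).induce (X : Set (Vertex f ℓ))).cliqueNum + 2 ≤ f (i + 2)
  swap
  · obtain ⟨x, hx, -⟩ := exists_child_vertex hf hℓ i p 0 (Or.inl rfl)
    exact ⟨x, hx, fun h => absurd h hk⟩
  by_cases hlen : ((layer f ℓ (i + 1)).up p).length < f (i + 2) - 1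
  · obtain ⟨x, hx, hup⟩ := exists_child_vertex hf hℓ i p 0 (Or.inl rfl)
    refine ⟨x, hx, fun _ z _ hz => ?_⟩
    rw [if_pos hlen] at hup
    unfold IsUp
    dsimp only
    rw [hup, List.mem_append, List.mem_singleton]
    rcases hz with rfl | hz
    · exact Or.inr rfl
    · exact Or.inl hz
  -- A full list has more entries than the clique number of `X`, so they cannot all be in `X`; an
  -- entry outside `X` is the one to drop.
  · obtain ⟨u, hu, huX⟩ : ∃ u : Vertex f ℓ, IsUp u ⟨i + 1, p⟩ ∧ u ∉ X := by
      by_contra! hc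
      have h1 := length_up_le_card hf hℓ (v := ⟨i + 1, p⟩)
        (s := X.filter fun u => IsUp u ⟨i + 1, p⟩)
        fun u hu => Finset.mem_filter.2 ⟨hc u hu, hu⟩
      have h2 := card_isUp_le_cliqueNum hf hℓ (v := ⟨i + 1, p⟩)
        (Finset.filter_subset (fun u => IsUp u ⟨i + 1, p⟩) X)
        fun u hu => (Finset.mem_filter.1 hu).2
      dsimp only at h1
      omega
    obtain ⟨a, ha, hau⟩ := List.getElem_of_mem hu
    obtain ⟨x, hx, hup⟩ := exists_child_vertex hf hℓ i p a (Or.inr ha)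
    refine ⟨x, hx, fun _ z hzX hz => ?_⟩
    rw [if_neg hlen] at hup
    unfold IsUp
    dsimp only
    rw [hup, List.mem_append, List.mem_singleton]
    rcases hz with rfl | hz
    · exact Or.inr rfl
    · left
      obtain ⟨b, hb, hbz⟩ := List.getElem_of_mem hz
      refine List.mem_eraseIdx_iff_getElem.2 ⟨b, hb, ?_, hbz⟩
      rintro rfl
      have : z = u := code_injective (hbz.symm.trans hau)
      exact huX (this ▸ hzX)

theorem treewidth_induce_le (hf : IsSlow f) (hℓ : 4 ≤ ℓ) (X : Finset (Vertex f ℓ)) (N : ℕ)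
    (hN : cumulative f (((layeredWheel f ℓ).induce (X : Set (Vertex f ℓ))).cliqueNum + 1) = N) :
    treewidth ((layeredWheel f ℓ).induce (X : Set (Vertex f ℓ))) ≤
      ((5 * (N + 2 * ((layeredWheel f ℓ).induce (X : Set (Vertex f ℓ))).cliqueNum) : ℕ) : ℕ∞)
        - 1 := by
  classical
  choose next hnext hkeep using exists_next hf hℓ X
  set k := ((layeredWheel f ℓ).induce (X : Set (Vertex f ℓ))).cliqueNum with hk
  let K := cover hf hℓ next hnext
  have htop : ∀ j n, K.pos j n ∈ (X : Set (Vertex f ℓ)) → j < X.sup (fun v => v.1) := by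
    intro j n h
    have : j + 1 ≤ X.sup fun v => v.1 := Finset.le_sup (f := fun v : Vertex f ℓ => v.1) h
    omega
  refine K.treewidth_le_of_own (M := N + 2 * k) (K.encard_own_le (N := N) ?_ ?_ htop) htop
  · intro j n hj z hz h
    -- Layer `j` of the cover is layer `j + 1` of the wheel, so children are in layer `j + 2`, which
    -- exceeds `N = F(k+1)`.
    have hfj : k + 2 ≤ f (j + 2) := by
      by_contra hc
      have := le_cumulative (f := f) (i := j + 2) (k := k + 1) (by omega) (by omega)
      rw [hN] at this
      have : j + 2 ≤ N := by exact_mod_cast this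
      omega
    have hpos : K.pos (j + 1) (K.next j n) = ⟨j + 2, next j (finRed _ (size_pos hf hℓ j) n)⟩ := by
      change posVertex hf hℓ (j + 1) (cyclicLift (size_pos hf hℓ j) (next j) n) = _
      rw [posVertex, finRed_cyclicLift]
    rw [hpos]
    exact hkeep j _ hfj z hz h
  · intro v
    have : {z | z ∈ (X : Set (Vertex f ℓ)) ∧ K.Up z v} =
        ((X.filter fun z => IsUp z v : Finset (Vertex f ℓ)) : Set (Vertex f ℓ)) := by
      ext z
      rw [Finset.coe_filter]
      rfl
    rw [this, Set.encard_coe_eq_coe_finsetCard]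
    exact_mod_cast card_isUp_le_cliqueNum hf hℓ (Finset.filter_subset _ X)
      fun u hu => (Finset.mem_filter.1 hu).2

/-! ### Clique number and treewidth of the first layers -/

/-- Vertices with upper neighbours sit at multiples of `ℓ - 2 ≥ 2`. The size of the layer is such a
multiple too, which handles the edge closing the cycle. -/
theorem not_adj_of_isUp_of_isUp (hf : IsSlow f) (hℓ : 4 ≤ ℓ) {u v w : Vertex f ℓ}
    (huv : u.1 = v.1) (hne : u ≠ v) (hwu : IsUp w u) (hwv : IsUp w v) :
    ¬ (layeredWheel f ℓ).Adj u v := by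
  obtain ⟨i, p, rfl⟩ := exists_eq_succ u
  obtain ⟨j, q⟩ := v
  dsimp only at huv
  subst huv
  have hreg := isRegular_layer hf hℓ i
  have hp := hreg.dvd_pos p (List.ne_nil_of_mem hwu)
  have hq := hreg.dvd_pos q (List.ne_nil_of_mem hwv)
  have hs := hreg.dvd_size ⟨p, List.ne_nil_of_mem hwu⟩
  have key : ∀ p q : Fin (layer f ℓ (i + 1)).size, ℓ - 2 ∣ (p : ℕ) → ℓ - 2 ∣ (q : ℕ) →
      (q : ℕ) ≠ ((p : ℕ) + 1) % (layer f ℓ (i + 1)).size := by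
    intro p q hp hq h
    have h1 : ℓ - 2 ∣ (p : ℕ) + 1 := (Nat.dvd_mod_iff hs).1 (h ▸ hq)
    have := Nat.le_of_dvd one_pos ((Nat.dvd_add_right hp).1 h1)
    omega
  intro h
  rcases ((SimpleGraph.fromRel_adj _ _ _).1 h).2 with (⟨-, h⟩ | h) | (⟨-, h⟩ | h)
  · exact key p q hp hq h
  · exact absurd (IsUp.lt hf hℓ h) (lt_irrefl _)
  · exact key q p hq hp h
  · exact absurd (IsUp.lt hf hℓ h) (lt_irrefl _)

/-- A layer is a cycle of length at least `ℓ ≥ 4`. -/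
theorem not_clique_of_same_layer (hf : IsSlow f) (hℓ : 4 ≤ ℓ) {u v w : Vertex f ℓ}
    (huv : u.1 = v.1) (huw : u.1 = w.1) (h1 : (layeredWheel f ℓ).Adj u v)
    (h2 : (layeredWheel f ℓ).Adj u w) : ¬ (layeredWheel f ℓ).Adj v w := by
  have key : ∀ u v : Vertex f ℓ, u.1 = v.1 → (layeredWheel f ℓ).Adj u v →
      (v.2 : ℕ) = ((u.2 : ℕ) + 1) % (layer f ℓ u.1).size ∨
        (u.2 : ℕ) = ((v.2 : ℕ) + 1) % (layer f ℓ u.1).size := by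
    intro u v huv h
    rcases ((SimpleGraph.fromRel_adj _ _ _).1 h).2 with (⟨-, h⟩ | h) | (⟨-, h⟩ | h)
    · exact Or.inl h
    · exact absurd (IsUp.lt hf hℓ h) (huv ▸ lt_irrefl _)
    · exact Or.inr (h.trans (congrArg (fun i => ((v.2 : ℕ) + 1) % (layer f ℓ i).size) huv.symm))
    · exact absurd (IsUp.lt hf hℓ h) (huv ▸ lt_irrefl _)
  intro h3
  have e1 := key u v huv h1
  have e2 := key u w huw h2
  have e3 := key v w (huv.symm.trans huw) h3
  obtain ⟨i, p, rfl⟩ := exists_eq_succ u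
  obtain ⟨j, q⟩ := v
  obtain ⟨j', r⟩ := w
  dsimp only at huv huw
  subst huv huw
  have hs := (isRegular_layer hf hℓ i).le_size
  dsimp only at e1 e2 e3
  have hmod : ∀ x : Fin (layer f ℓ (i + 1)).size,
      ((x : ℕ) + 1) % (layer f ℓ (i + 1)).size = x + 1 ∧ (x : ℕ) + 1 < (layer f ℓ (i + 1)).size ∨
      ((x : ℕ) + 1) % (layer f ℓ (i + 1)).size = 0 ∧ (x : ℕ) + 1 = (layer f ℓ (i + 1)).size := by
    intro x
    rcases (Nat.succ_le_of_lt x.2).eq_or_lt with h | h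
    · exact Or.inr ⟨by rw [Nat.succ_eq_add_one] at h; rw [h, Nat.mod_self], h⟩
    · exact Or.inl ⟨Nat.mod_eq_of_lt h, h⟩
  have hp := hmod p
  have hq := hmod q
  have hr := hmod r
  omega

/-- Take a vertex `v` of the clique in the highest layer. If another one shares its layer, a third
can be neither in that layer nor a common upper neighbour. Otherwise all the others are among the at
most `f v.1 - 1` upper neighbours of `v`. -/
theorem card_le_of_isClique (hf : IsSlow f) (hℓ : 4 ≤ ℓ) {s : Finset (Vertex f ℓ)} {T : ℕ}
    (hs : (layeredWheel f ℓ).IsClique (s : Set (Vertex f ℓ))) (hT : ∀ v ∈ s, v.1 ≤ T) :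
    s.card ≤ max 2 (f T) := by
  classical
  rcases s.eq_empty_or_nonempty with rfl | hne
  · simp
  obtain ⟨v, hv, hmax⟩ := s.exists_max_image (fun v => v.1) hne
  by_cases h : ∃ u ∈ s, u ≠ v ∧ u.1 = v.1
  · obtain ⟨u, hu, huv, heq⟩ := h
    refine le_trans ?_ (le_max_left _ _)
    refine (Finset.card_le_card (t := {u, v}) fun w hw => ?_).trans Finset.card_le_two
    by_contra hc
    rw [Finset.mem_insert, Finset.mem_singleton, not_or] at hc
    have a1 := hs hu hv huv
    have a2 := hs hu hw (Ne.symm hc.1)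
    have a3 := hs hv hw (Ne.symm hc.2)
    rcases (hmax w hw).eq_or_lt with hlw | hlw
    · exact not_clique_of_same_layer hf hℓ heq (heq.trans hlw.symm) a1 a2 a3
    · have key : ∀ x : Vertex f ℓ, w.1 < x.1 → (layeredWheel f ℓ).Adj x w → IsUp w x := by
        intro x hx h
        rcases ((SimpleGraph.fromRel_adj _ _ _).1 h).2 with (⟨h, -⟩ | h) | (⟨h, -⟩ | h)
        · exact absurd h hx.ne'
        · exact absurd (IsUp.lt hf hℓ h) hx.not_gt
        · exact absurd h hx.ne
        · exact h
      exact not_adj_of_isUp_of_isUp hf hℓ heq huv (key u (heq ▸ hlw) a2) (key v hlw a3) a1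
  · push Not at h
    refine le_trans ?_ (le_max_right _ _)
    have hup : ∀ u ∈ s.erase v, IsUp u v := by
      intro u hu
      rw [Finset.mem_erase] at hu
      have hlt : u.1 < v.1 := lt_of_le_of_ne (hmax u hu.2) (h u hu.2 hu.1)
      rcases ((SimpleGraph.fromRel_adj _ _ _).1 (hs hu.2 hv hu.1)).2 with
        (⟨h, -⟩ | h) | (⟨h, -⟩ | h)
      · exact absurd h hlt.ne
      · exact h
      · exact absurd h hlt.ne'
      · exact absurd (IsUp.lt hf hℓ h) hlt.not_gt
    have h1 := card_le_length_up hup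
    rw [Finset.card_erase_of_mem hv] at h1
    have hvT := hT v hv
    have hv1 := one_le_layer v
    have h2 := length_up_le hf hℓ v
    have h3 := hf.le_of_le hv1 hvT
    have h4 := hf.one_le hv1
    omega

/-- The first `T` layers of the wheel. -/
def firstLayers (f : ℕ → ℕ) (ℓ T : ℕ) : Finset (Vertex f ℓ) :=
  (Finset.range (T + 1)).sigma fun _ => Finset.univ

theorem mem_firstLayers {T : ℕ} {v : Vertex f ℓ} : v ∈ firstLayers f ℓ T ↔ v.1 ≤ T := by
  simp [firstLayers]

theorem cliqueNum_firstLayers (hf : IsSlow f) (hℓ : 4 ≤ ℓ) {T : ℕ} (hT : 1 ≤ T) (h2 : 2 ≤ f T) :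
    ((layeredWheel f ℓ).induce (firstLayers f ℓ T : Set (Vertex f ℓ))).cliqueNum = f T := by
  classical
  apply le_antisymm
  · obtain ⟨s, hsX, hs, hcard⟩ :=
      (layeredWheel f ℓ).exists_isClique_card_eq_cliqueNum_induce (firstLayers f ℓ T)
    rw [← hcard]
    refine (card_le_of_isClique hf hℓ hs fun v hv => mem_firstLayers.1 (hsX hv)).trans ?_
    exact max_le h2 le_rfl
  · obtain ⟨i, rfl⟩ : ∃ i, T = i + 1 := ⟨T - 1, by omega⟩
    obtain ⟨p, hp⟩ := (isRegular_layer hf hℓ i).exists_length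
    set v : Vertex f ℓ := ⟨i + 1, p⟩
    set s := (firstLayers f ℓ (i + 1)).filter (fun u => IsUp u v)
    have hvs : v ∉ s := fun h => lt_irrefl _ ((Finset.mem_filter.1 h).2.lt hf hℓ)
    have h1 := length_up_le_card hf hℓ (s := s) (v := v) fun u hu =>
      Finset.mem_filter.2 ⟨mem_firstLayers.2 (hu.lt hf hℓ).le, hu⟩
    have hclique : (layeredWheel f ℓ).IsClique ((insert v s : Finset _) : Set (Vertex f ℓ)) := by
      refine isClique_of_isUp hf hℓ (v := v) fun u hu => ?_
      rcases Finset.mem_insert.1 hu with h | h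
      · exact Or.inl h
      · exact Or.inr (Finset.mem_filter.1 h).2
    have h3 := hclique.card_le_cliqueNum_induce (X := firstLayers f ℓ (i + 1)) (by
      intro u hu
      rcases Finset.mem_insert.1 hu with rfl | h
      · exact mem_firstLayers.2 le_rfl
      · exact (Finset.mem_filter.1 h).1)
    rw [Finset.card_insert_of_notMem hvs] at h3
    change ((layer f ℓ (i + 1)).up p).length ≤ _ at h1
    omega

/-- Descendants can be chosen to keep a given upper neighbour: a full list has at least two entries,
since `f (j + 2) ≥ 3`, so another one can be dropped. -/
theorem exists_isUp_of_lt (hf : IsSlow f) (hℓ : 4 ≤ ℓ) {i j : ℕ} (hij : i < j)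
    (p : Fin (layer f ℓ (i + 1)).size) :
    ∃ q : Fin (layer f ℓ (j + 1)).size, IsUp (⟨i + 1, p⟩ : Vertex f ℓ) ⟨j + 1, q⟩ := by
  induction j, hij using Nat.le_induction with
  | base =>
    obtain ⟨x, -, hup⟩ := exists_child_vertex hf hℓ i p 0 (Or.inl rfl)
    refine ⟨x, ?_⟩
    change _ ∈ (layer f ℓ (i + 2)).up x
    rw [hup]
    exact List.mem_append_right _ (List.mem_singleton.2 rfl)
  | succ j hij ih =>
    obtain ⟨q, hq⟩ := ih
    by_cases hlen : ((layer f ℓ (j + 1)).up q).length < f (j + 2) - 1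
    · obtain ⟨x, -, hup⟩ := exists_child_vertex hf hℓ j q 0 (Or.inl rfl)
      refine ⟨x, ?_⟩
      change _ ∈ (layer f ℓ (j + 2)).up x
      rw [hup, if_pos hlen]
      exact List.mem_append_left _ hq
    · obtain ⟨b, hb, hbq⟩ := List.getElem_of_mem hq
      have h3 := hf.three_le (i := j + 2) (by omega)
      obtain ⟨a, ha, hab⟩ : ∃ a < ((layer f ℓ (j + 1)).up q).length, b ≠ a := by
        by_cases h : b = 0
        · exact ⟨1, by omega, by omega⟩
        · exact ⟨0, by omega, h⟩
      obtain ⟨x, -, hup⟩ := exists_child_vertex hf hℓ j q a (Or.inr ha)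
      refine ⟨x, ?_⟩
      change _ ∈ (layer f ℓ (j + 2)).up x
      rw [hup, if_neg hlen]
      exact List.mem_append_left _ (List.mem_eraseIdx_iff_getElem.2 ⟨b, hb, hab, hbq⟩)

/-- All positions are joined through position `0`; the edge closing the cycle is not needed. -/
theorem reflTransGen_layer (hf : IsSlow f) (hℓ : 4 ≤ ℓ) {T i : ℕ} (hi : i < T)
    (u v : ((firstLayers f ℓ T : Finset (Vertex f ℓ)) : Set (Vertex f ℓ)))
    (hu : u.1.1 = i + 1) (hv : v.1.1 = i + 1) :
    Relation.ReflTransGen (fun x y => ((layeredWheel f ℓ).induce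
      (firstLayers f ℓ T : Set (Vertex f ℓ))).Adj x y ∧ y.1.1 = i + 1) u v := by
  have hmem : ∀ p : Fin (layer f ℓ (i + 1)).size,
      (⟨i + 1, p⟩ : Vertex f ℓ) ∈ (firstLayers f ℓ T : Set (Vertex f ℓ)) :=
    fun p => mem_firstLayers.2 (by change i + 1 ≤ T; omega)
  have hadj : ∀ n (hn : n + 1 < (layer f ℓ (i + 1)).size), (layeredWheel f ℓ).Adj
      ⟨i + 1, ⟨n, by omega⟩⟩ ⟨i + 1, ⟨n + 1, hn⟩⟩ := by
    intro n hn
    refine (SimpleGraph.fromRel_adj _ _ _).2 ⟨?_, Or.inl (Or.inl ⟨rfl, ?_⟩)⟩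
    · intro h
      have := congrArg Fin.val (eq_of_heq (Sigma.mk.inj h).2)
      dsimp only at this
      omega
    · exact (Nat.mod_eq_of_lt hn).symm
  have hs := size_pos hf hℓ i
  have key : ∀ n (hn : n < (layer f ℓ (i + 1)).size),
      Relation.ReflTransGen (fun x y => ((layeredWheel f ℓ).induce
        (firstLayers f ℓ T : Set (Vertex f ℓ))).Adj x y ∧ y.1.1 = i + 1)
        ⟨⟨i + 1, ⟨0, hs⟩⟩, hmem _⟩ ⟨⟨i + 1, ⟨n, hn⟩⟩, hmem _⟩ ∧
      Relation.ReflTransGen (fun x y => ((layeredWheel f ℓ).induce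
        (firstLayers f ℓ T : Set (Vertex f ℓ))).Adj x y ∧ y.1.1 = i + 1)
        ⟨⟨i + 1, ⟨n, hn⟩⟩, hmem _⟩ ⟨⟨i + 1, ⟨0, hs⟩⟩, hmem _⟩ := by
    intro n hn
    induction n with
    | zero => exact ⟨Relation.ReflTransGen.refl, Relation.ReflTransGen.refl⟩
    | succ n ih =>
      obtain ⟨h1, h2⟩ := ih (by omega)
      exact ⟨h1.tail ⟨hadj n hn, rfl⟩, h2.head ⟨SimpleGraph.induce_adj.2 (hadj n hn).symm, rfl⟩⟩
  obtain ⟨⟨a, p⟩, hu'⟩ := u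
  obtain ⟨⟨b, q⟩, hv'⟩ := v
  dsimp only at hu hv
  subst hu hv
  exact (key p p.2).2.trans (key q q.2).1

theorem sub_one_le_treewidth_firstLayers (hf : IsSlow f) (hℓ : 4 ≤ ℓ) (T : ℕ) :
    (T : ℕ∞) - 1 ≤
      treewidth ((layeredWheel f ℓ).induce (firstLayers f ℓ T : Set (Vertex f ℓ))) := by
  have hmem : ∀ i < T, ∀ p : Fin (layer f ℓ (i + 1)).size,
      (⟨i + 1, p⟩ : Vertex f ℓ) ∈ (firstLayers f ℓ T : Set (Vertex f ℓ)) :=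
    fun i hi p => mem_firstLayers.2 (by change i + 1 ≤ T; omega)
  have key : ∀ i j, i < j → j < T →
      ∃ u : ((firstLayers f ℓ T : Finset (Vertex f ℓ)) : Set (Vertex f ℓ)), u.1.1 = i + 1 ∧
      ∃ v : ((firstLayers f ℓ T : Finset (Vertex f ℓ)) : Set (Vertex f ℓ)), v.1.1 = j + 1 ∧
      ((layeredWheel f ℓ).induce (firstLayers f ℓ T : Set (Vertex f ℓ))).Adj u v := by
    intro i j hij hj
    obtain ⟨q, hq⟩ := exists_isUp_of_lt hf hℓ hij ⟨0, size_pos hf hℓ i⟩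
    exact ⟨⟨_, hmem i (by omega) _⟩, rfl, ⟨_, hmem j hj q⟩, rfl, hq.adj hf hℓ⟩
  have h := card_sub_one_le_treewidth (G := (layeredWheel f ℓ).induce
    (firstLayers f ℓ T : Set (Vertex f ℓ))) (Finset.range T) (fun i => {v | v.1.1 = i + 1})
    (by
      intro i _ j _ v hi hj
      rw [Set.mem_ofPred_eq] at hi hj
      omega)
    (fun i hi u hu v hv => reflTransGen_layer hf hℓ (Finset.mem_range.1 hi) u v hu hv)
    (fun i hi => ⟨⟨_, hmem i (Finset.mem_range.1 hi) ⟨0, size_pos hf hℓ i⟩⟩, rfl⟩)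
    (by
      intro i hi j hj hij
      rw [Finset.mem_range] at hi hj
      rcases lt_or_gt_of_ne hij with h | h
      · exact key i j h hj
      · obtain ⟨u, hu, v, hv, huv⟩ := key j i h hi
        exact ⟨v, hv, u, hu, huv.symm⟩)
  rwa [Finset.card_range] at h

end LayeredWheel

/-! ### Assembling the two bounds -/

theorem mainTheorem4 (f : ℕ → ℕ) (hf : IsSlow f) (ℓ : ℕ) (hℓ : 4 ≤ ℓ) :
    (∀ X : Finset (LayeredWheel.Vertex f ℓ), X.Nonempty →
      treewidth ((layeredWheel f ℓ).induce (X : Set (LayeredWheel.Vertex f ℓ))) ≤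
        15 * (cumulative f
              (((layeredWheel f ℓ).induce (X : Set (LayeredWheel.Vertex f ℓ))).cliqueNum + 1) +
            ((ℓ : ℕ∞) + 1) *
              (((layeredWheel f ℓ).induce (X : Set (LayeredWheel.Vertex f ℓ))).cliqueNum : ℕ∞) -
            2)) ∧
    (∀ k : ℕ, 2 ≤ k → cumulative f (k - 1) ≠ ⊤ → ∀ t : ℕ, (t : ℕ∞) ≤ cumulative f k →
      ∃ X : Finset (LayeredWheel.Vertex f ℓ),
        ((layeredWheel f ℓ).induce (X : Set (LayeredWheel.Vertex f ℓ))).cliqueNum = k ∧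
        (t : ℕ∞) - 1 ≤
          treewidth ((layeredWheel f ℓ).induce (X : Set (LayeredWheel.Vertex f ℓ)))) := by
  constructor
  · rintro X ⟨v, hv⟩
    have hk : 1 ≤ ((layeredWheel f ℓ).induce (X : Set (LayeredWheel.Vertex f ℓ))).cliqueNum := by
      have := SimpleGraph.IsClique.card_le_cliqueNum_induce (G := layeredWheel f ℓ) (X := X)
        (s := {v}) (by simp) (by simpa using hv)
      simpa using this
    set k := ((layeredWheel f ℓ).induce (X : Set (LayeredWheel.Vertex f ℓ))).cliqueNum with hkdef
    rcases eq_or_ne (cumulative f (k + 1)) ⊤ with htop | htop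
    · have hrhs : (15 : ℕ∞) * (cumulative f (k + 1) + ((ℓ : ℕ∞) + 1) * (k : ℕ∞) - 2) = ⊤ := by
        rw [htop, top_add, ENat.top_sub_ofNat, ENat.mul_top (by simp)]
      rw [hrhs]
      exact le_top
    · obtain ⟨N, hN⟩ := ENat.ne_top_iff_exists.1 htop
      have hN2 : 2 ≤ N := by
        have := le_cumulative (f := f) (i := 2) (k := k + 1) (by omega) (by rw [hf.two]; omega)
        rw [← hN] at this
        exact_mod_cast this
      refine (LayeredWheel.treewidth_induce_le hf hℓ X N hN.symm).trans ?_
      rw [← hkdef, ← hN]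
      have h5 : 5 * k ≤ (ℓ + 1) * k := Nat.mul_le_mul_right k (by omega)
      -- There is ample room, as `N ≥ 2`, `k ≥ 1` and `ℓ + 1 ≥ 5`.
      have : 5 * (N + 2 * k) - 1 ≤ 15 * (N + (ℓ + 1) * k - 2) := by omega
      exact_mod_cast this
  · intro k hk hfin t ht
    obtain ⟨N, hN⟩ := ENat.ne_top_iff_exists.1 hfin
    have hN1 : 1 ≤ N := by
      have := le_cumulative (f := f) (i := 1) (k := k - 1) le_rfl (by rw [hf.one]; omega)
      rw [← hN] at this
      exact_mod_cast this
    have h1 : f N ≤ k - 1 := hf.le_of_le_cumulative hN1 hN.le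
    have h2 := hf.step N hN1
    have h3 : ¬ f (N + 1) ≤ k - 1 := by
      intro h
      have := le_cumulative (f := f) (i := N + 1) (by omega) h
      rw [← hN] at this
      have : N + 1 ≤ N := by exact_mod_cast this
      omega
    -- With `N = F(k-1)`, layer `N + 1` is the first where `f` reaches `k`, and `t ≤ F(k)` gives `f
    -- t ≤ k`. The maximum makes the clique number exactly `k` even for small `t`.
    have hfT : f (max t (N + 1)) = k := by
      rcases le_total t (N + 1) with h | h
      · rw [max_eq_right h]; omega
      · rw [max_eq_left h]
        have := hf.le_of_le_cumulative (by omega) ht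
        have := hf.le_of_le (by omega) h
        omega
    refine ⟨LayeredWheel.firstLayers f ℓ (max t (N + 1)), ?_, ?_⟩
    · rw [LayeredWheel.cliqueNum_firstLayers hf hℓ (by omega) (by omega), hfT]
    · refine le_trans ?_ (LayeredWheel.sub_one_le_treewidth_firstLayers hf hℓ _)
      exact tsub_le_tsub_right (by exact_mod_cast le_max_left t (N + 1)) 1
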